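/- Let $n,k,d,m$ be positive integers, let $\mathbb{C}[X]=\mathbb{C}[X_1,\dots,X_n]$ and let $\mathbb{C}[X]_j$ denote the space of forms of degree $j$. Let $$V_{k,d}=\{[q^d] : q\in\mathbb{C}[X]_k,\ q\neq 0\}\subseteq\mathbb{P}(\mathbb{C}[X]_{kd})$$ be the variety of $d$-th powers of forms of degree $k$, and let its $m$-th secant variety $$\sigma_m(V_{k,d})=\overline{\bigcup_{x_1,\dots,x_m\in V_{k,d}}\langle x_1,\dots,x_m\rangle}\subseteq\mathbb{P}(\mathbb{C}[X]_{kd})$$ be the Zariski closure of the union of the projective subspaces spanned by $m$ points of $V_{k,d}$. Assume that $$m\le\frac{\dim\mathbb{C}[X]_{kd}}{\dim\mathbb{C}[X]_k}-\dim\mathbb{C}[X]_k .$$ Then $\sigma_m(V_{k,d})$ has the expected dimension, that is, $$\dim\sigma_m(V_{k,d})=m\cdot\dim\mathbb{C}[X]_k-1 .$$ Moreover (and equivalently), for general $p_1,\dots,p_m\in\mathbb{C}[X]_k$, i.e. for all $(p_1,\dots,p_m)$ in some non-empty Zariski-open subset of $(\mathbb{C}[X]_k)^m$, the degree-$kd$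 part of the ideal $(p_1^{d-1},\dots,p_m^{d-1})\subseteq\mathbb{C}[X]$ has the maximal dimension $m\cdot\dim\mathbb{C}[X]_k$. -/

import Mathlib

namespace PowersOfForms

section Zariski

variable {K V : Type*} [Field K] [AddCommGroup V] [Module K V]

/-- The value at `v` of a polynomial in the linear functionals on `V`. When `V` is
finite-dimensional these are exactly the polynomial functions on `V`, without a choice of
coordinates. -/
noncomputable def evalAt (v : V) (F : MvPolynomial (Module.Dual K V) K) : K :=
  MvPolynomial.eval (fun φ : Module.Dual K V => φ v) F

/-- The common zeros in `ℙ(V)` of a set `S` of polynomials. It is used only for sets of homogeneous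
polynomials, for which the vanishing does not depend on the representative. -/
def projZeroLocus (S : Set (MvPolynomial (Module.Dual K V) K)) : Set (Projectivization K V) :=
  {x | ∀ F ∈ S, evalAt x.rep F = 0}

/-- The Zariski topology of `ℙ(V)`: the closed sets are the common zero sets of homogeneous
polynomials (of possibly different degrees). -/
@[reducible] noncomputable def projZariski (K V : Type*) [Field K] [AddCommGroup V] [Module K V] :
    TopologicalSpace (Projectivization K V) :=
  TopologicalSpace.ofClosed
    {Z | ∃ S : Set (MvPolynomial (Module.Dual K V) K),
      (∀ F ∈ S, ∃ e : ℕ, F.IsHomogeneous e) ∧ Z = projZeroLocus S}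
    (by
      refine ⟨{1}, ?_, ?_⟩
      · rintro F rfl
        exact ⟨0, MvPolynomial.isHomogeneous_one _ _⟩
      · ext x
        simp [projZeroLocus, evalAt])
    (by
      intro A hA
      refine ⟨{F | (∃ e : ℕ, F.IsHomogeneous e) ∧
        ∃ Z ∈ A, ∀ x ∈ Z, evalAt (Projectivization.rep x) F = 0}, fun F hF => hF.1, ?_⟩
      ext x
      constructor
      · rintro hx F ⟨-, Z, hZ, hF⟩
        exact hF x (hx Z hZ)
      · intro hx Z hZ
        obtain ⟨S, hS, rfl⟩ := hA hZ
        intro F hF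
        exact hx F ⟨hS F hF, _, hZ, fun y hy => hy F hF⟩)
    (by
      rintro Z₁ ⟨S₁, h₁, rfl⟩ Z₂ ⟨S₂, h₂, rfl⟩
      refine ⟨{F | ∃ F₁ ∈ S₁, ∃ F₂ ∈ S₂, F = F₁ * F₂}, ?_, ?_⟩
      · rintro F ⟨F₁, hF₁, F₂, hF₂, rfl⟩
        obtain ⟨a, ha⟩ := h₁ F₁ hF₁
        obtain ⟨b, hb⟩ := h₂ F₂ hF₂
        exact ⟨a + b, ha.mul hb⟩
      · ext x
        constructor
        · rintro (hx | hx) F ⟨F₁, hF₁, F₂, hF₂, rfl⟩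
          · have h := hx F₁ hF₁
            simp only [evalAt] at h
            simp [evalAt, h]
          · have h := hx F₂ hF₂
            simp only [evalAt] at h
            simp [evalAt, h]
        · intro hx
          by_contra hcon
          simp only [Set.mem_union, not_or, projZeroLocus, Set.mem_ofPred_eq, not_forall] at hcon
          obtain ⟨⟨F₁, hF₁, hn₁⟩, F₂, hF₂, hn₂⟩ := hcon
          have h := hx (F₁ * F₂) ⟨F₁, hF₁, F₂, hF₂, rfl⟩
          simp only [evalAt, map_mul] at h
          exact (mul_ne_zero hn₁ hn₂) h)

/-- The dimension of a subset of `ℙ(V)`: the Krull dimension of its Zariski topology, that is, the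
supremum of the lengths of chains of irreducible closed subsets. -/
noncomputable def projDim (Z : Set (Projectivization K V)) : WithBot ℕ∞ :=
  letI : TopologicalSpace (Projectivization K V) := projZariski K V
  topologicalKrullDim Z

/-- The `m`-th secant variety of `W ⊆ ℙ(V)`: the Zariski closure of the union of the projective
subspaces spanned by `m` points of `W`. -/
noncomputable def secantVariety (m : ℕ) (W : Set (Projectivization K V)) :
    Set (Projectivization K V) :=
  letI : TopologicalSpace (Projectivization K V) := projZariski K V
  closure (⋃ x : Fin m → W, {y | y.submodule ≤ ⨆ i, (x i : Projectivization K V).submodule})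

/-- `P` holds for a general `v` in the finite-dimensional space `V`: it holds on a non-empty
Zariski-open subset, namely wherever some polynomial function, not identically zero, does not
vanish. -/
def HoldsForGeneral (K : Type*) {V : Type*} [Field K] [AddCommGroup V] [Module K V]
    (P : V → Prop) : Prop :=
  ∃ F : MvPolynomial (Module.Dual K V) K,
    (∃ v : V, evalAt v F ≠ 0) ∧ ∀ v : V, evalAt v F ≠ 0 → P v

end Zariski

/-- `ℂ[X]_k`, the space of forms of degree `k` in `n` variables. -/
noncomputable abbrev Form (n k : ℕ) : Submodule ℂ (MvPolynomial (Fin n) ℂ) :=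
  MvPolynomial.homogeneousSubmodule (Fin n) ℂ k

/-- `dim ℂ[X]_k`. -/
noncomputable def dimForm (n k : ℕ) : ℕ := Module.finrank ℂ (Form n k)

/-- The `d`-th power of a form of degree `k`, as a form of degree `k * d`. -/
noncomputable def formPow {n k : ℕ} (d : ℕ) (q : Form n k) : Form n (k * d) :=
  ⟨(q : MvPolynomial (Fin n) ℂ) ^ d,
    ((MvPolynomial.mem_homogeneousSubmodule k _).1 q.2).pow d⟩

theorem formPow_ne_zero {n k : ℕ} (d : ℕ) {q : Form n k} (hq : q ≠ 0) : formPow d q ≠ 0 := by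
  intro h
  have h' : (q : MvPolynomial (Fin n) ℂ) ^ d = 0 := congrArg Subtype.val h
  exact pow_ne_zero d (fun h0 => hq (Subtype.ext h0)) h'

/-- `V_{k,d} ⊆ ℙ(ℂ[X]_{kd})`, the variety of `d`-th powers of forms of degree `k`. -/
def powerVariety (n k d : ℕ) : Set (Projectivization ℂ (Form n (k * d))) :=
  {x | ∃ (q : Form n k) (hq : q ≠ 0),
    x = Projectivization.mk ℂ (formPow d q) (formPow_ne_zero d hq)}

/-- The degree-`e` part of the ideal `(g₁, …, g_m)` of `ℂ[X]`. -/
noncomputable def idealPart {n m : ℕ} (g : Fin m → MvPolynomial (Fin n) ℂ) (e : ℕ) :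
    Submodule ℂ (MvPolynomial (Fin n) ℂ) :=
  (Ideal.span (Set.range g)).restrictScalars ℂ ⊓ Form n e

end PowersOfForms

/-! Put N = dim ℂ[X]_k and T(q) = q^(d-1)·ℂ[X]_k, the image of the differential of q ↦ q^d. The
degree-kd part of the ideal is T(p_1) + … + T(p_m) (`idealPart_eq_map`), which is also the image of
the differential of (q_i) ↦ ∑ q_i^d. Both claims therefore follow once this sum has dimension mN for
general p. The hypothesis says mN + N² ≤ dim ℂ[X]_{kd}.

Let w j be the dimension of the sum at j general points. The dimension formula makes w concave, and
T at a further general point meets the sum in dimension N - (w (j+1) - w j). Suppose that this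
increment is below N and equals the next one. Then the intersection is nonzero and does not change
when the j points are exchanged for others, so one fixed nonzero form lies in the sum for general p.
Such forms make up a GL_n-stable subspace, and ℂ[X]_{kd} is irreducible, so the sum is the whole
space (`generic_finrank_eq_of_increments_eq`). Hence increments below N strictly decrease until the
space is filled. If one dropped below N before step m, a negative increment would occur within N
further steps, as w i ≤ iN < (m+N)N leaves the space unfilled for i < m+N. This contradicts
monotonicity (`generic_finrank_eq_mul`).

For the secant variety, d-th roots of scalars turn the union of spans into the projective image of
(q_i) ↦ ∑ q_i^d. The closure of the image of a homogeneous polynomial map on E with injective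
differential somewhere has dimension dim E - 1 (`projDim_closure_projImage`). The upper bound
compares chains of irreducible closed sets with transcendence degrees of cone ideals; the lower
bound restricts the map to successive hyperplanes and separates the images by the Jacobian
criterion. -/

namespace PowersOfForms

/-! ### Polynomial functions and properties of general points. -/

section PolyFun

variable {K V V' : Type*} [Field K] [AddCommGroup V] [Module K V] [AddCommGroup V'] [Module K V']

/-- The algebra of polynomial functions on `V`. -/
def polyFun (K V : Type*) [Field K] [AddCommGroup V] [Module K V] : Subalgebra K (V → K) :=
  Algebra.adjoin K (Set.range fun φ : Module.Dual K V => (φ : V → K))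

theorem dual_mem_polyFun (φ : Module.Dual K V) : (φ : V → K) ∈ polyFun K V :=
  Algebra.subset_adjoin ⟨φ, rfl⟩

theorem const_mem_polyFun (c : K) : (fun _ : V => c) ∈ polyFun K V :=
  (polyFun K V).algebraMap_mem c

theorem polyFun_add {f g : V → K} (hf : f ∈ polyFun K V) (hg : g ∈ polyFun K V) :
    (fun v => f v + g v) ∈ polyFun K V :=
  (polyFun K V).add_mem hf hg

theorem polyFun_mul {f g : V → K} (hf : f ∈ polyFun K V) (hg : g ∈ polyFun K V) :
    (fun v => f v * g v) ∈ polyFun K V :=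
  (polyFun K V).mul_mem hf hg

theorem polyFun_sum {ι : Type*} (s : Finset ι) {f : ι → V → K}
    (hf : ∀ i ∈ s, f i ∈ polyFun K V) : (fun v => ∑ i ∈ s, f i v) ∈ polyFun K V := by
  have : (fun v => ∑ i ∈ s, f i v) = ∑ i ∈ s, f i := by
    ext v
    simp
  rw [this]
  exact (polyFun K V).sum_mem hf

theorem polyFun_prod {ι : Type*} (s : Finset ι) {f : ι → V → K}
    (hf : ∀ i ∈ s, f i ∈ polyFun K V) : (fun v => ∏ i ∈ s, f i v) ∈ polyFun K V := by
  have : (fun v => ∏ i ∈ s, f i v) = ∏ i ∈ s, f i := by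
    ext v
    simp
  rw [this]
  exact (polyFun K V).prod_mem hf

theorem evalAt_mem_polyFun (F : MvPolynomial (Module.Dual K V) K) :
    (fun v => evalAt v F) ∈ polyFun K V := by
  induction F using MvPolynomial.induction_on with
  | C a => simpa [evalAt] using const_mem_polyFun a
  | add p q hp hq => simpa [evalAt] using polyFun_add hp hq
  | mul_X p φ hp => simpa [evalAt] using polyFun_mul hp (dual_mem_polyFun φ)

theorem exists_evalAt_eq {f : V → K} (hf : f ∈ polyFun K V) :
    ∃ F : MvPolynomial (Module.Dual K V) K, ∀ v, evalAt v F = f v := by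
  induction hf using Algebra.adjoin_induction with
  | mem x hx =>
    obtain ⟨φ, rfl⟩ := hx
    exact ⟨MvPolynomial.X φ, fun v => by simp [evalAt]⟩
  | algebraMap r => exact ⟨MvPolynomial.C r, fun v => by simp [evalAt]⟩
  | add x y _ _ hx hy =>
    obtain ⟨F, hF⟩ := hx
    obtain ⟨G, hG⟩ := hy
    exact ⟨F + G, fun v => by simp [← hF, ← hG, evalAt]⟩
  | mul x y _ _ hx hy =>
    obtain ⟨F, hF⟩ := hx
    obtain ⟨G, hG⟩ := hy
    exact ⟨F * G, fun v => by simp [← hF, ← hG, evalAt]⟩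

/-- A map is polynomial when its composition with every linear functional is. -/
def IsPolyMap (K : Type*) {V V' : Type*} [Field K] [AddCommGroup V] [Module K V]
    [AddCommGroup V'] [Module K V'] (g : V' → V) : Prop :=
  ∀ ψ : Module.Dual K V, (fun v => ψ (g v)) ∈ polyFun K V'

theorem polyFun_comp {f : V → K} (hf : f ∈ polyFun K V) {g : V' → V} (hg : IsPolyMap K g) :
    (fun v => f (g v)) ∈ polyFun K V' := by
  induction hf using Algebra.adjoin_induction with
  | mem x hx =>
    obtain ⟨φ, rfl⟩ := hx
    exact hg φ
  | algebraMap r => exact const_mem_polyFun r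
  | add x y _ _ hx hy => exact (polyFun K V').add_mem hx hy
  | mul x y _ _ hx hy => exact (polyFun K V').mul_mem hx hy

theorem LinearMap.isPolyMap (ℓ : V' →ₗ[K] V) : IsPolyMap K ℓ := fun ψ =>
  dual_mem_polyFun (ψ ∘ₗ ℓ)

theorem isPolyMap_const (c : V) : IsPolyMap K (fun _ : V' => c) := fun ψ =>
  const_mem_polyFun (ψ c)

theorem IsPolyMap.add {f g : V' → V} (hf : IsPolyMap K f) (hg : IsPolyMap K g) :
    IsPolyMap K (fun v => f v + g v) := fun ψ => by
  simpa using polyFun_add (hf ψ) (hg ψ)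

theorem exists_polynomial_eval_eq {f : K → K} (hf : f ∈ polyFun K K) :
    ∃ P : Polynomial K, ∀ t, P.eval t = f t := by
  induction hf using Algebra.adjoin_induction with
  | mem x hx =>
    obtain ⟨φ, rfl⟩ := hx
    refine ⟨Polynomial.C (φ 1) * Polynomial.X, fun t => ?_⟩
    have : φ t = t * φ 1 := by simpa using φ.map_smul t (1 : K)
    change _ = φ t
    rw [this, Polynomial.eval_mul, Polynomial.eval_C, Polynomial.eval_X, mul_comm]
  | algebraMap r => exact ⟨Polynomial.C r, fun v => by simp⟩
  | add x y _ _ hx hy =>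
    obtain ⟨F, hF⟩ := hx
    obtain ⟨G, hG⟩ := hy
    exact ⟨F + G, fun v => by simp [← hF, ← hG]⟩
  | mul x y _ _ hx hy =>
    obtain ⟨F, hF⟩ := hx
    obtain ⟨G, hG⟩ := hy
    exact ⟨F * G, fun v => by simp [← hF, ← hG]⟩

theorem exists_mvPolynomial_eval_eq {ι : Type*} [Fintype ι] {f : (ι → K) → K}
    (hf : f ∈ polyFun K (ι → K)) : ∃ P : MvPolynomial ι K, ∀ c, MvPolynomial.eval c P = f c := by
  classical
  induction hf using Algebra.adjoin_induction with
  | mem x hx =>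
    obtain ⟨φ, rfl⟩ := hx
    refine ⟨∑ i, MvPolynomial.C (φ (Pi.single i 1)) * MvPolynomial.X i, fun c => ?_⟩
    simp only [map_sum, map_mul, MvPolynomial.eval_C, MvPolynomial.eval_X]
    conv_rhs => rw [LinearMap.pi_apply_eq_sum_univ φ c]
    simp only [smul_eq_mul, mul_comm]
    refine Finset.sum_congr rfl fun i _ => ?_
    congr 2
    ext j
    simp [Pi.single_apply, eq_comm]
  | algebraMap r => exact ⟨MvPolynomial.C r, fun v => by simp⟩
  | add x y _ _ hx hy =>
    obtain ⟨F, hF⟩ := hx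
    obtain ⟨G, hG⟩ := hy
    exact ⟨F + G, fun v => by simp [← hF, ← hG]⟩
  | mul x y _ _ hx hy =>
    obtain ⟨F, hF⟩ := hx
    obtain ⟨G, hG⟩ := hy
    exact ⟨F * G, fun v => by simp [← hF, ← hG]⟩

/-- On the line through `v` and `w` both functions become nonzero polynomials in one variable, and
so does their product. This is the irreducibility of `V`, and it lets general conditions be
combined. -/
theorem exists_ne_zero_and_ne_zero [Infinite K] {f g : V → K} (hf : f ∈ polyFun K V)
    (hg : g ∈ polyFun K V) {v w : V} (hv : f v ≠ 0) (hw : g w ≠ 0) :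
    ∃ u, f u ≠ 0 ∧ g u ≠ 0 := by
  have hline : IsPolyMap K (fun t : K => (LinearMap.toSpanSingleton K V (w - v)) t + v) :=
    (LinearMap.isPolyMap _).add (isPolyMap_const v)
  obtain ⟨P, hP⟩ := exists_polynomial_eval_eq (polyFun_comp hf hline)
  obtain ⟨Q, hQ⟩ := exists_polynomial_eval_eq (polyFun_comp hg hline)
  have hP0 : P ≠ 0 := by
    rintro rfl
    have := hP 0
    simp at this
    exact hv this.symm
  have hQ0 : Q ≠ 0 := by
    rintro rfl
    have := hQ 1
    simp at this
    exact hw this.symm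
  obtain ⟨t, ht⟩ : ∃ t, (P * Q).eval t ≠ 0 := by
    by_contra! h
    exact mul_ne_zero hP0 hQ0 (Polynomial.funext fun t => by simp [h t])
  rw [Polynomial.eval_mul, hP, hQ] at ht
  exact ⟨_, left_ne_zero_of_mul ht, right_ne_zero_of_mul ht⟩

theorem holdsForGeneral_iff {P : V → Prop} :
    HoldsForGeneral K P ↔
      ∃ f ∈ polyFun K V, (∃ v, f v ≠ 0) ∧ ∀ v, f v ≠ 0 → P v := by
  constructor
  · rintro ⟨F, h⟩
    exact ⟨_, evalAt_mem_polyFun F, h⟩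
  · rintro ⟨f, hf, h⟩
    obtain ⟨F, hF⟩ := exists_evalAt_eq hf
    refine ⟨F, ?_⟩
    simpa only [hF] using h

theorem HoldsForGeneral.mono {P Q : V → Prop} (h : HoldsForGeneral K P) (hPQ : ∀ v, P v → Q v) :
    HoldsForGeneral K Q := by
  obtain ⟨F, hF, h⟩ := h
  exact ⟨F, hF, fun v hv => hPQ v (h v hv)⟩

theorem HoldsForGeneral.exists {P : V → Prop} (h : HoldsForGeneral K P) : ∃ v, P v := by
  obtain ⟨F, ⟨v, hv⟩, h⟩ := h
  exact ⟨v, h v hv⟩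

theorem holdsForGeneral_of_forall {P : V → Prop} (h : ∀ v, P v) : HoldsForGeneral K P :=
  holdsForGeneral_iff.2 ⟨1, (polyFun K V).one_mem, ⟨0, by simp⟩, fun v _ => h v⟩

theorem HoldsForGeneral.and [Infinite K] {P Q : V → Prop} (hP : HoldsForGeneral K P)
    (hQ : HoldsForGeneral K Q) : HoldsForGeneral K fun v => P v ∧ Q v := by
  rw [holdsForGeneral_iff] at *
  obtain ⟨f, hf, ⟨v, hv⟩, hP⟩ := hP
  obtain ⟨g, hg, ⟨w, hw⟩, hQ⟩ := hQ
  obtain ⟨u, hu, hu'⟩ := exists_ne_zero_and_ne_zero hf hg hv hw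
  refine ⟨f * g, (polyFun K V).mul_mem hf hg, ⟨u, mul_ne_zero hu hu'⟩, fun x hx => ?_⟩
  exact ⟨hP x (left_ne_zero_of_mul hx), hQ x (right_ne_zero_of_mul hx)⟩

theorem HoldsForGeneral.forall_finset [Infinite K] {ι : Type*} (s : Finset ι) {P : ι → V → Prop}
    (h : ∀ i ∈ s, HoldsForGeneral K (P i)) : HoldsForGeneral K fun v => ∀ i ∈ s, P i v := by
  classical
  induction s using Finset.induction_on with
  | empty => exact holdsForGeneral_of_forall (by simp)
  | insert a s _ ih =>
    refine ((h a (by simp)).and (ih fun i hi => h i (by simp [hi]))).mono fun v hv => ?_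
    simpa using hv

theorem HoldsForGeneral.forall_finite [Infinite K] {ι : Type*} [Finite ι] {P : ι → V → Prop}
    (h : ∀ i, HoldsForGeneral K (P i)) : HoldsForGeneral K fun v => ∀ i, P i v := by
  have := Fintype.ofFinite ι
  exact (HoldsForGeneral.forall_finset Finset.univ fun i _ => h i).mono fun v hv i =>
    hv i (Finset.mem_univ i)

theorem HoldsForGeneral.comp_surjective {P : V → Prop} (h : HoldsForGeneral K P)
    {ℓ : V' →ₗ[K] V} (hℓ : Function.Surjective ℓ) : HoldsForGeneral K fun v => P (ℓ v) := by
  rw [holdsForGeneral_iff] at *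
  obtain ⟨f, hf, ⟨v, hv⟩, hP⟩ := h
  obtain ⟨u, rfl⟩ := hℓ v
  exact ⟨_, polyFun_comp hf (LinearMap.isPolyMap ℓ), ⟨u, hv⟩, fun x hx => hP _ hx⟩

/-- A polynomial function vanishing wherever another nonzero one does not vanish is zero. -/
theorem eq_zero_of_forall_holdsForGeneral [Infinite K] {f : V → K} (hf : f ∈ polyFun K V)
    (h : HoldsForGeneral K fun v => f v = 0) (v : V) : f v = 0 := by
  by_contra hv
  obtain ⟨u, hu, hu'⟩ := (h.and (holdsForGeneral_iff.2 ⟨f, hf, ⟨v, hv⟩, fun _ => id⟩)).exists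
  exact hu' hu

end PolyFun

open Module

/-! ### Growth of the generic rank of a sum of subspaces. -/

section GenericRank

variable {K A L : Type*} [Field K] [Infinite K] [AddCommGroup A] [Module K A] [AddCommGroup L]
  [Module K L] [FiniteDimensional K L] {T : A → Submodule K L} {w : ℕ → ℕ}

omit [Infinite K] in
-- By semicontinuity the largest rank attained at `j` points is attained generally.
theorem exists_generic_finrank
    (hsemi : ∀ j r, (∃ p : Fin j → A, r ≤ finrank K ↥(⨆ i, T (p i))) →
      HoldsForGeneral K fun p : Fin j → A => r ≤ finrank K ↥(⨆ i, T (p i))) :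
    ∃ w : ℕ → ℕ, ∀ j, HoldsForGeneral K fun p : Fin j → A => finrank K ↥(⨆ i, T (p i)) = w j := by
  classical
  refine ⟨fun j => Nat.findGreatest (fun r => ∃ p : Fin j → A, r ≤ finrank K ↥(⨆ i, T (p i)))
    (finrank K L), fun j => ?_⟩
  have h0 : ∃ p : Fin j → A, 0 ≤ finrank K ↥(⨆ i, T (p i)) := ⟨0, Nat.zero_le _⟩
  refine (hsemi j _ (Nat.findGreatest_spec
    (P := fun r => ∃ p : Fin j → A, r ≤ finrank K ↥(⨆ i, T (p i)))
    (n := finrank K L) (Nat.zero_le _) h0)).mono fun p hp => ?_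
  refine le_antisymm (Nat.le_findGreatest (Submodule.finrank_le _) ⟨p, le_rfl⟩) hp

omit [FiniteDimensional K L] in
theorem holdsForGeneral_finrank_finset {ι : Type*} [Finite ι]
    (hw : ∀ j, HoldsForGeneral K fun p : Fin j → A => finrank K ↥(⨆ i, T (p i)) = w j) :
    HoldsForGeneral K fun p : ι → A =>
      ∀ s : Finset ι, finrank K ↥(⨆ i ∈ s, T (p i)) = w s.card := by
  refine HoldsForGeneral.forall_finite fun s => ?_
  let e : Fin s.card ≃ s := s.equivFin.symm
  have hinj : Function.Injective fun i : Fin s.card => (e i : ι) :=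
    Subtype.val_injective.comp e.injective
  refine ((hw s.card).comp_surjective
    (LinearMap.funLeft_surjective_of_injective K A _ hinj)).mono fun p hp => ?_
  rw [← hp, iSup_subtype', ← e.iSup_comp]
  rfl

section Tuple

variable {ι : Type*} [DecidableEq ι] {p : ι → A}
  (hp : ∀ s : Finset ι, finrank K ↥(⨆ i ∈ s, T (p i)) = w s.card)

include hp

omit [Infinite K] [AddCommGroup A] [Module K A] in
-- The sums over `s ∪ {a}` and `s ∪ {b}` both contain the sum over `s`; apply the dimension formula
-- to them.
theorem generic_finrank_concave {s : Finset ι} {a b : ι} (ha : a ∉ s) (hb : b ∉ s)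
    (hab : a ≠ b) : w (s.card + 2) + w s.card ≤ 2 * w (s.card + 1) := by
  have h := Submodule.finrank_sup_add_finrank_inf_eq (⨆ i ∈ insert a s, T (p i))
    (⨆ i ∈ insert b s, T (p i))
  have h1 : (⨆ i ∈ insert a s, T (p i)) ⊔ (⨆ i ∈ insert b s, T (p i)) =
      ⨆ i ∈ insert a (insert b s), T (p i) := by
    simp only [Finset.iSup_insert]
    rw [sup_sup_sup_comm, sup_idem, sup_assoc]
  have h2 : (⨆ i ∈ s, T (p i)) ≤
      (⨆ i ∈ insert a s, T (p i)) ⊓ (⨆ i ∈ insert b s, T (p i)) := by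
    simp only [Finset.iSup_insert]
    exact le_inf le_sup_right le_sup_right
  have h3 := Submodule.finrank_mono h2
  rw [h1, hp, hp, hp, Finset.card_insert_of_notMem (by simp [ha, hab]),
    Finset.card_insert_of_notMem hb, Finset.card_insert_of_notMem ha] at h
  rw [hp] at h3
  have : s.card + 1 + 1 = s.card + 2 := rfl
  rw [this] at h
  omega

omit [Infinite K] [AddCommGroup A] [Module K A] in
theorem generic_finrank_mono {s : Finset ι} {a : ι} (ha : a ∉ s) :
    w s.card ≤ w (s.card + 1) := by
  rw [← Finset.card_insert_of_notMem ha, ← hp, ← hp, Finset.iSup_insert]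
  exact Submodule.finrank_mono le_sup_right

omit [Infinite K] [AddCommGroup A] [Module K A] in
-- The amount by which an increment falls short of `w 1` is the dimension of the overlap with the
-- new subspace.
theorem generic_finrank_inf {s : Finset ι} {q : ι} (hq : q ∉ s) :
    finrank K ↥(T (p q) ⊓ ⨆ i ∈ s, T (p i)) + w (s.card + 1) = w 1 + w s.card := by
  have h := Submodule.finrank_sup_add_finrank_inf_eq (T (p q)) (⨆ i ∈ s, T (p i))
  have h1 := hp {q}
  rw [Finset.iSup_singleton, Finset.card_singleton] at h1
  rw [← Finset.iSup_insert (t := fun i => T (p i)), hp, hp, h1, Finset.card_insert_of_notMem hq] at h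
  omega

omit [Infinite K] [AddCommGroup A] [Module K A] in
-- Equal increments give the two nested intersections the same dimension.
theorem generic_inf_insert {s : Finset ι} {a q : ι} (hq : q ∉ s) (ha : a ∉ s) (haq : a ≠ q)
    (hs : w (s.card + 2) + w s.card = 2 * w (s.card + 1)) :
    (T (p q) ⊓ ⨆ i ∈ insert a s, T (p i)) = T (p q) ⊓ ⨆ i ∈ s, T (p i) := by
  symm
  have h1 := generic_finrank_inf hp hq
  have h2 := generic_finrank_inf hp (s := insert a s) (q := q) (by simp [hq, haq.symm])
  rw [Finset.card_insert_of_notMem ha] at h2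
  have : s.card + 1 + 1 = s.card + 2 := rfl
  rw [this] at h2
  refine Submodule.eq_of_le_of_finrank_eq ?_ (by omega)
  rw [Finset.iSup_insert]
  exact inf_le_inf_left _ le_sup_right

omit [Infinite K] [AddCommGroup A] [Module K A] in
-- The set `s` is turned into `s'` by exchanging one index at a time. Each exchange passes through
-- the union of the old and the new set, which has `j + 1` elements and gives the same intersection
-- as either.
theorem generic_inf_eq_inf {j : ℕ} (hj : w (j + 2) + w j = 2 * w (j + 1)) {q : ι}
    {s s' : Finset ι} (hs : s.card = j) (hs' : s'.card = j) (hq : q ∉ s) (hq' : q ∉ s') :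
    (T (p q) ⊓ ⨆ i ∈ s, T (p i)) = T (p q) ⊓ ⨆ i ∈ s', T (p i) := by
  induction hn : (s' \ s).card generalizing s with
  | zero =>
    rw [Finset.card_eq_zero, Finset.sdiff_eq_empty_iff_subset] at hn
    rw [Finset.eq_of_subset_of_card_le hn (by omega)]
  | succ n ih =>
    obtain ⟨a, ha⟩ : (s' \ s).Nonempty := Finset.card_pos.1 (by omega)
    obtain ⟨has', has⟩ := Finset.mem_sdiff.1 ha
    have hcard : (s \ s').card = (s' \ s).card := Finset.card_sdiff_comm (by omega)
    obtain ⟨b, hb⟩ : (s \ s').Nonempty := Finset.card_pos.1 (by omega)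
    obtain ⟨hbs, hbs'⟩ := Finset.mem_sdiff.1 hb
    have hab : a ≠ b := fun h => has (h ▸ hbs)
    have haq : a ≠ q := fun h => hq' (h ▸ has')
    have hbq : b ≠ q := fun h => hq (h ▸ hbs)
    have hae : a ∉ s.erase b := by simp [has]
    have hc : (insert a (s.erase b)).card = j := by
      rw [Finset.card_insert_of_notMem hae, Finset.card_erase_add_one hbs, hs]
    have hqn : q ∉ insert a (s.erase b) := by simp [hq, haq.symm]
    rw [← ih hc hqn ?_, ← generic_inf_insert hp hq has haq (by rw [hs]; exact hj),
      ← generic_inf_insert hp (a := b) hqn (by simp [hab.symm]) hbq (by rw [hc]; exact hj)]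
    · congr 3
      rw [Finset.insert_comm, Finset.insert_erase hbs]
    · have : s' \ insert a (s.erase b) = (s' \ s).erase a := by
        ext x
        simp only [Finset.mem_sdiff, Finset.mem_insert, Finset.mem_erase]
        constructor
        · rintro ⟨h1, h2⟩
          refine ⟨fun h => h2 (Or.inl h), h1, fun h => h2 (Or.inr ⟨?_, h⟩)⟩
          rintro rfl
          exact hbs' h1
        · tauto
      rw [this, Finset.card_erase_of_mem ha]
      omega

end Tuple

omit [FiniteDimensional K L] [Infinite K] in
theorem isPolyMap_sumElim {ι κ : Type*} (b : κ → A) :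
    IsPolyMap K fun p : ι → A => (Sum.elim p b : ι ⊕ κ → A) := by
  have h : (fun p : ι → A => (Sum.elim p b : ι ⊕ κ → A)) = fun p =>
      (LinearMap.pi fun i : ι ⊕ κ =>
        Sum.elim (fun i => LinearMap.proj i) (fun _ => (0 : (ι → A) →ₗ[K] A)) i) p +
      Sum.elim (fun _ => 0) b := by
    ext p i
    cases i <;> simp
  rw [h]
  exact (LinearMap.isPolyMap _).add (isPolyMap_const _)

/-- If two consecutive increments of the generic rank agree and are not maximal, then the tangent
spaces already span everything. -/
theorem generic_finrank_eq_of_increments_eq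
    (hw : ∀ j, HoldsForGeneral K fun p : Fin j → A => finrank K ↥(⨆ i, T (p i)) = w j)
    (hirr : ∀ j, ∀ x : L, x ≠ 0 → (HoldsForGeneral K fun p : Fin j → A => x ∈ ⨆ i, T (p i)) →
      ∀ y : L, HoldsForGeneral K fun p : Fin j → A => y ∈ ⨆ i, T (p i))
    {j : ℕ} (hj : w (j + 2) + w j = 2 * w (j + 1)) (hlt : w (j + 1) < w j + w 1) :
    w j = finrank K L := by
  classical
  -- The tuple consists of `j` points that will vary (`s'`), one point `q`, and `j` points that stay
  -- frozen (`s`).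
  have hgen := holdsForGeneral_finrank_finset (ι := Fin j ⊕ Option (Fin j)) hw
  rw [holdsForGeneral_iff] at hgen
  obtain ⟨f, hf, ⟨p₀, hp₀⟩, hgood⟩ := hgen
  let q : Fin j ⊕ Option (Fin j) := Sum.inr none
  let s : Finset (Fin j ⊕ Option (Fin j)) := Finset.univ.image fun i => Sum.inr (some i)
  let s' : Finset (Fin j ⊕ Option (Fin j)) := Finset.univ.image Sum.inl
  have hs : s.card = j := by
    rw [Finset.card_image_of_injective _ fun a b h => by simpa using h]
    simp
  have hs' : s'.card = j := by
    rw [Finset.card_image_of_injective _ fun a b h => by simpa using h]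
    simp
  have hq : q ∉ s := by simp [q, s]
  have hq' : q ∉ s' := by simp [q, s']
  have hinf := generic_finrank_inf (hgood p₀ hp₀) hq
  rw [hs] at hinf
  have hne : (T (p₀ q) ⊓ ⨆ i ∈ s, T (p₀ i)) ≠ ⊥ := by
    intro h
    rw [h, finrank_bot] at hinf
    omega
  obtain ⟨x, hx, hx0⟩ := Submodule.exists_mem_ne_zero_of_ne_bot hne
  -- The vector `x` depends only on the frozen points. As long as the whole tuple is general, the
  -- intersection over `s` equals the one over `s'`, so `x` lies in the sum at the varying points.
  have key : HoldsForGeneral K fun p : Fin j → A => x ∈ ⨆ i, T (p i) := by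
    rw [holdsForGeneral_iff]
    refine ⟨_, polyFun_comp hf (isPolyMap_sumElim fun i => p₀ (Sum.inr i)),
      ⟨fun i => p₀ (Sum.inl i), ?_⟩, fun p hp => ?_⟩
    · convert hp₀ using 2
      ext i
      cases i <;> rfl
    · have h := generic_inf_eq_inf (hgood _ hp) hj hs hs' hq hq'
      have hx' : x ∈ T (Sum.elim p (fun i => p₀ (Sum.inr i)) q) ⊓
          ⨆ i ∈ s, T (Sum.elim p (fun i => p₀ (Sum.inr i)) i) := by
        simpa only [q, s, Finset.iSup_finset_image, Sum.elim_inr] using hx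
      rw [h] at hx'
      simpa only [s', Finset.iSup_finset_image, Sum.elim_inl, Finset.mem_univ, iSup_pos]
        using (Submodule.mem_inf.1 hx').2
  have hall := hirr j x hx0 key
  let b := Module.finBasis K L
  obtain ⟨p, hpb, hpw⟩ := ((HoldsForGeneral.forall_finite fun i => hall (b i)).and (hw j)).exists
  have htop : (⨆ i, T (p i)) = ⊤ := by
    rw [eq_top_iff, ← b.span_eq, Submodule.span_le]
    rintro _ ⟨i, rfl⟩
    exact hpb i
  rw [← hpw, htop, finrank_top]

/-- The generic rank is maximal in the range `m * N + N ^ 2 ≤ dim L`. -/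
theorem generic_finrank_eq_mul
    (hw : ∀ j, HoldsForGeneral K fun p : Fin j → A => finrank K ↥(⨆ i, T (p i)) = w j)
    (hirr : ∀ j, ∀ x : L, x ≠ 0 → (HoldsForGeneral K fun p : Fin j → A => x ∈ ⨆ i, T (p i)) →
      ∀ y : L, HoldsForGeneral K fun p : Fin j → A => y ∈ ⨆ i, T (p i))
    (hN0 : 0 < w 1) {m : ℕ} (hm : m * w 1 + w 1 ^ 2 ≤ finrank K L) : w m = m * w 1 := by
  have hw0 : w 0 = 0 := by
    obtain ⟨p, hp⟩ := (hw 0).exists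
    rw [← hp]
    simp
  have hconc : ∀ j, w (j + 2) + w j ≤ 2 * w (j + 1) := fun j => by
    obtain ⟨p, hp⟩ := (holdsForGeneral_finrank_finset (ι := Fin j ⊕ Bool) hw).exists
    have := generic_finrank_concave hp (s := Finset.univ.image Sum.inl) (a := Sum.inr true)
      (b := Sum.inr false) (by simp) (by simp) (by simp)
    rw [Finset.card_image_of_injective _ fun a b h => by simpa using h] at this
    simpa using this
  have hmono : ∀ j, w j ≤ w (j + 1) := fun j => by
    obtain ⟨p, hp⟩ := (holdsForGeneral_finrank_finset (ι := Fin j ⊕ Unit) hw).exists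
    have := generic_finrank_mono hp (s := Finset.univ.image Sum.inl) (a := Sum.inr ()) (by simp)
    rw [Finset.card_image_of_injective _ fun a b h => by simpa using h] at this
    simpa using this
  have hstep : ∀ j, w (j + 1) ≤ w j + w 1 := fun j => by
    induction j with
    | zero => simp [hw0]
    | succ j ih => have := hconc j; rw [show j + 1 + 1 = j + 2 from rfl]; omega
  have hle : ∀ j, w j ≤ j * w 1 := fun j => by
    induction j with
    | zero => simp [hw0]
    | succ j ih => have := hstep j; rw [Nat.succ_mul]; omega
  by_contra hne
  obtain ⟨j, hjm, hj⟩ : ∃ j < m, w (j + 1) < w j + w 1 := by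
    by_contra! h
    refine hne (le_antisymm (hle m) ?_)
    have : ∀ i ≤ m, i * w 1 ≤ w i := fun i => by
      induction i with
      | zero => simp [hw0]
      | succ i ih => intro hi; have := h i hi; have := ih (by omega); rw [Nat.succ_mul]; omega
    exact this m le_rfl
  have hbig : ∀ i < m + w 1, w i < finrank K L := fun i hi => by
    calc w i ≤ i * w 1 := hle i
      _ < (m + w 1) * w 1 := Nat.mul_lt_mul_of_pos_right hi hN0
      _ ≤ finrank K L := by nlinarith
  -- The increment at `j + i` is less than `w 1 - i`; at `i = w 1` it would be negative.
  have hdec : ∀ i ≤ w 1, w (j + i + 1) + i < w (j + i) + w 1 := fun i => by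
    induction i with
    | zero => intro _; simpa using hj
    | succ i ih =>
      intro hi
      have h1 := ih (by omega)
      have h2 := hconc (j + i)
      rcases h2.lt_or_eq with h2 | h2
      · have e1 : j + (i + 1) + 1 = j + i + 2 := by omega
        have e2 : j + (i + 1) = j + i + 1 := by omega
        rw [e1, e2]
        omega
      · have h3 := generic_finrank_eq_of_increments_eq hw hirr h2 (by omega)
        have h4 := hbig (j + i) (by omega)
        omega
  have h1 := hdec (w 1) le_rfl
  have h2 := hmono (j + w 1)
  omega

end GenericRank

open MvPolynomial

/-! ### Lower semicontinuity of the rank. -/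

section Semicontinuity

variable {K V L : Type*} [Field K] [AddCommGroup V] [Module K V] [AddCommGroup L] [Module K L]
  [FiniteDimensional K L]

/-- The rank of a finite family of vectors depending polynomially on parameters is lower
semicontinuous. -/
theorem holdsForGeneral_le_finrank_span {ι : Type*} [Finite ι] {g : ι → V → L}
    (hg : ∀ i, IsPolyMap K (g i)) {r : ℕ} {v₀ : V}
    (hr : r ≤ finrank K (Submodule.span K (Set.range fun i => g i v₀))) :
    HoldsForGeneral K fun v => r ≤ finrank K (Submodule.span K (Set.range fun i => g i v)) := by
  classical
  obtain ⟨e, he⟩ : ∃ e : Fin r → ι, LinearIndependent K fun a => g (e a) v₀ := by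
    obtain ⟨b, hb, hspan, hli⟩ := exists_linearIndependent K (Set.range fun i => g i v₀)
    have hbf : b.Finite := (Set.finite_range _).subset hb
    have := hbf.fintype
    rw [← hspan, finrank_span_set_eq_card hli] at hr
    obtain ⟨c⟩ : Nonempty (Fin r ↪ b) := Function.Embedding.nonempty_of_card_le (by
      rw [Fintype.card_fin, ← Set.toFinset_card]
      exact hr)
    choose i hi using fun x : b => hb x.2
    refine ⟨fun a => i (c a), ?_⟩
    have := hli.comp c c.injective
    convert this using 1
    ext a
    exact hi (c a)
  -- Coordinates dual to the chosen vectors at `v₀` make their coordinate matrix the identity there;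
  -- its determinant is the polynomial function sought.
  obtain ⟨R, hR⟩ := (Fintype.linearCombination K fun a => g (e a) v₀).exists_leftInverse_of_injective
    (LinearMap.ker_eq_bot.2 he.fintypeLinearCombination_injective)
  have hR1 : ∀ a, R (g (e a) v₀) = Pi.single a 1 := fun a => by
    have := LinearMap.congr_fun hR (Pi.single a 1)
    simpa [Fintype.linearCombination_apply_single] using this
  let M : V → Matrix (Fin r) (Fin r) K := fun v a => R (g (e a) v)
  rw [holdsForGeneral_iff]
  refine ⟨fun v => (M v).det, ?_, ⟨v₀, ?_⟩, fun v hv => ?_⟩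
  · simp only [Matrix.det_apply]
    refine polyFun_sum _ fun σ _ => ?_
    have h := (polyFun K V).zsmul_mem (polyFun_prod Finset.univ (f := fun i v => M v (σ i) i)
      fun i _ => hg (e (σ i)) (LinearMap.proj i ∘ₗ R)) (Equiv.Perm.sign σ : ℤ)
    exact h
  · have : M v₀ = 1 := by
      ext a b
      simp [M, hR1, Matrix.one_apply, Pi.single_apply, eq_comm]
    simp [this]
  · have hli : LinearIndependent K fun a => g (e a) v :=
      LinearIndependent.of_comp R (Matrix.linearIndependent_rows_of_det_ne_zero hv)
    have h1 := finrank_span_eq_card hli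
    rw [Fintype.card_fin] at h1
    rw [← h1]
    refine Submodule.finrank_mono (Submodule.span_mono ?_)
    rintro _ ⟨a, rfl⟩
    exact ⟨e a, rfl⟩

end Semicontinuity

/-! ### Polynomial-valued maps with polynomial coefficients. -/

section CoeffPoly

variable {K V σ : Type*} [Field K] [AddCommGroup V] [Module K V]

/-- The maps into a polynomial ring all of whose coefficients are polynomial functions. -/
def coeffPoly (K V σ : Type*) [Field K] [AddCommGroup V] [Module K V] :
    Subalgebra K (V → MvPolynomial σ K) where
  carrier := {f | ∀ m, (fun v => coeff m (f v)) ∈ polyFun K V}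
  mul_mem' {f g} hf hg m := by
    classical
    simp only [Pi.mul_apply, coeff_mul]
    exact polyFun_sum _ fun x _ => polyFun_mul (hf _) (hg _)
  add_mem' {f g} hf hg m := by
    simp only [Pi.add_apply, coeff_add]
    exact polyFun_add (hf _) (hg _)
  algebraMap_mem' r m := by
    simp only [Pi.algebraMap_apply]
    exact const_mem_polyFun _

theorem const_mem_coeffPoly (P : MvPolynomial σ K) : (fun _ : V => P) ∈ coeffPoly K V σ :=
  fun _ => const_mem_polyFun _

theorem linear_mem_coeffPoly (ℓ : V →ₗ[K] MvPolynomial σ K) : (ℓ : V → _) ∈ coeffPoly K V σ :=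
  fun m => dual_mem_polyFun (lcoeff K m ∘ₗ ℓ)

end CoeffPoly

theorem IsHomogeneous.aeval_mul {σ R A : Type*} [CommSemiring R] [CommSemiring A] [Algebra R A]
    {φ : MvPolynomial σ R} {e : ℕ} (hφ : φ.IsHomogeneous e) (r : A) (g : σ → A) :
    aeval (fun i => r * g i) φ = r ^ e * aeval g φ := by
  rw [aeval_def, aeval_def, eval₂_eq, eval₂_eq, Finset.mul_sum]
  refine Finset.sum_congr rfl fun m hm => ?_
  rw [hφ.degree_eq_sum_deg_support hm]
  simp only [mul_pow, Finset.prod_mul_distrib, Finset.prod_pow_eq_pow_sum]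
  ring

/-! ### Linear substitutions and irreducibility of the space of forms. -/

section Forms

variable {n : ℕ}

instance finiteDimensional_form (n e : ℕ) : FiniteDimensional ℂ (Form n e) :=
  Module.Finite.iff_fg.2 (homogeneousSubmodule_fg _ _ e)

/-- The exponents of the monomials of degree `e`. -/
def degExp (n e : ℕ) : Finset (Fin n →₀ ℕ) := Finset.univ.finsuppAntidiag e

theorem mem_degExp {e : ℕ} {m : Fin n →₀ ℕ} : m ∈ degExp n e ↔ m.degree = e := by
  simp [degExp, Finsupp.degree_eq_sum]

theorem form_eq_sum {e : ℕ} {P : MvPolynomial (Fin n) ℂ} (hP : P ∈ Form n e) :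
    P = ∑ m ∈ degExp n e, coeff m P • monomial m 1 := by
  conv_lhs => rw [P.as_sum]
  simp only [smul_monomial, smul_eq_mul, mul_one]
  refine Finset.sum_subset (fun m hm => ?_) fun m _ hm => ?_
  · rw [mem_degExp]
    by_contra h
    exact mem_support_iff.1 hm (IsHomogeneous.coeff_eq_zero hP h)
  · rw [notMem_support_iff.1 hm, monomial_zero]

theorem isPolyMap_form {V : Type*} [AddCommGroup V] [Module ℂ V] {e : ℕ} {f : V → Form n e}
    (hf : (fun v => (f v : MvPolynomial (Fin n) ℂ)) ∈ coeffPoly ℂ V (Fin n)) : IsPolyMap ℂ f := by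
  intro ψ
  obtain ⟨ψ', hψ'⟩ := LinearMap.exists_extend ψ
  have h : (fun v => ψ (f v)) = fun v => ∑ m ∈ degExp n e,
      coeff m (f v : MvPolynomial (Fin n) ℂ) * ψ' (monomial m 1) := by
    ext v
    rw [← hψ', LinearMap.comp_apply, Submodule.subtype_apply]
    conv_lhs => rw [form_eq_sum (f v).2]
    simp
  rw [h]
  exact polyFun_sum _ fun m _ => polyFun_mul (hf m) (const_mem_polyFun _)

/-- The linear form with coefficients `u`. -/
noncomputable def linForm (u : Fin n → ℂ) : MvPolynomial (Fin n) ℂ := ∑ i, C (u i) * X i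

theorem linForm_isHomogeneous (u : Fin n → ℂ) : (linForm u).IsHomogeneous 1 :=
  IsHomogeneous.sum _ _ _ fun _ _ => isHomogeneous_C_mul_X _ _

/-- The powers of linear forms span the space of forms. -/
theorem eq_top_of_linForm_pow_mem {e : ℕ} (S : Submodule ℂ (Form n e))
    (hS : ∀ (u : Fin n → ℂ) (h : linForm u ^ e ∈ Form n e), (⟨linForm u ^ e, h⟩ : Form n e) ∈ S) :
    S = ⊤ := by
  classical
  by_contra hne
  obtain ⟨ψ, hψ, hker⟩ := Submodule.exists_le_ker_of_lt_top S (lt_top_iff_ne_top.2 hne)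
  obtain ⟨ψ', hψ'⟩ := LinearMap.exists_extend ψ
  have hpow : ∀ u : Fin n → ℂ, ψ' (linForm u ^ e) = 0 := fun u => by
    have hmem : linForm u ^ e ∈ Form n e := by
      simpa using (linForm_isHomogeneous u).pow e
    have := hker (hS u hmem)
    rw [LinearMap.mem_ker, ← hψ'] at this
    exact this
  -- As a function of `u`, the value of `ψ'` at `linForm u ^ e` is a polynomial whose coefficients
  -- are multinomial coefficients times the values of `ψ'` on monomials. It vanishes identically,
  -- and the multinomials are nonzero in ℂ.
  let c : (Fin n → ℕ) → ℂ := fun k => ψ' (monomial (Finsupp.equivFunOnFinite.symm k) 1)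
  let P : MvPolynomial (Fin n) ℂ := ∑ k ∈ Finset.piAntidiag Finset.univ e,
    monomial (Finsupp.equivFunOnFinite.symm k) (Nat.multinomial Finset.univ k * c k)
  have hP : P = 0 := by
    refine MvPolynomial.funext fun u => ?_
    rw [map_zero, ← hpow u, linForm, Finset.sum_pow_eq_sum_piAntidiag, map_sum, map_sum]
    refine Finset.sum_congr rfl fun k _ => ?_
    have h1 : (Nat.multinomial Finset.univ k : MvPolynomial (Fin n) ℂ) *
        ∏ i, (C (u i) * X i) ^ k i =
        ((Nat.multinomial Finset.univ k : ℂ) * ∏ i, u i ^ k i) •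
          monomial (Finsupp.equivFunOnFinite.symm k) 1 := by
      have h2 : (monomial (Finsupp.equivFunOnFinite.symm k) 1 : MvPolynomial (Fin n) ℂ) =
          ∏ i, X i ^ k i := by
        rw [monomial_eq, Finsupp.prod_fintype _ _ (by simp)]
        simp
      rw [h2, smul_eq_C_mul]
      simp only [mul_pow, Finset.prod_mul_distrib, map_mul, map_prod, map_pow, map_natCast]
      ring
    rw [h1, map_smul, eval_monomial, Finsupp.prod_fintype _ _ (by simp)]
    simp [c]
    ring
  have hc : ∀ k ∈ Finset.piAntidiag Finset.univ e, c k = 0 := fun k hk => by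
    have h1 : coeff (Finsupp.equivFunOnFinite.symm k) P = Nat.multinomial Finset.univ k * c k := by
      simp only [P, coeff_sum, coeff_monomial, EmbeddingLike.apply_eq_iff_eq]
      rw [Finset.sum_ite_eq' _ k, if_pos hk]
    rw [hP, coeff_zero] at h1
    rcases mul_eq_zero.1 h1.symm with h | h
    · exact absurd h (by exact_mod_cast (Nat.multinomial_pos _ _).ne')
    · exact h
  apply hψ
  ext x
  rw [← hψ', LinearMap.comp_apply, Submodule.subtype_apply, form_eq_sum x.2, map_sum]
  refine Finset.sum_eq_zero fun m hm => ?_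
  have := hc m (by
    rw [Finset.mem_piAntidiag]
    exact ⟨by rw [← Finsupp.degree_eq_sum]; exact mem_degExp.1 hm, by simp⟩)
  have h2 : Finsupp.equivFunOnFinite.symm (m : Fin n → ℕ) = m := by ext; simp
  simp only [c, h2] at this
  rw [map_smul, this, smul_zero]

/-- Substitution of linear forms for the variables. -/
noncomputable def subst (A : Matrix (Fin n) (Fin n) ℂ) :
    MvPolynomial (Fin n) ℂ →ₐ[ℂ] MvPolynomial (Fin n) ℂ :=
  aeval fun i => linForm (A i)

theorem subst_subst (A B : Matrix (Fin n) (Fin n) ℂ) (P : MvPolynomial (Fin n) ℂ) :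
    subst A (subst B P) = subst (B * A) P := by
  refine AlgHom.congr_fun (φ₁ := (subst A).comp (subst B)) ?_ P
  ext1 i
  simp only [subst, AlgHom.comp_apply, aeval_X, linForm, map_sum, map_mul, Matrix.mul_apply,
    Finset.mul_sum, Finset.sum_mul, algHom_C, algebraMap_eq]
  rw [Finset.sum_comm]
  simp only [mul_assoc]

theorem subst_one (P : MvPolynomial (Fin n) ℂ) : subst 1 P = P := by
  have : subst (1 : Matrix (Fin n) (Fin n) ℂ) = AlgHom.id ℂ _ := by
    ext1 i
    simp [subst, linForm, Matrix.one_apply]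
  rw [this]
  rfl

/-- Substitution of linear forms for the variables, on forms of degree `e`. -/
noncomputable def substForm (A : Matrix (Fin n) (Fin n) ℂ) (e : ℕ) : Form n e →ₗ[ℂ] Form n e :=
  (subst A).toLinearMap.restrict fun P hP => by
    have h := IsHomogeneous.aeval (n := 1) hP _ fun i => linForm_isHomogeneous (A i)
    rw [one_mul] at h
    exact h

theorem substForm_inv (A : Matrix (Fin n) (Fin n) ℂ) (hA : A.det ≠ 0) (e : ℕ) (P : Form n e) :
    substForm A e (substForm A⁻¹ e P) = P := by
  ext1
  change subst A (subst A⁻¹ P) = P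
  rw [subst_subst, Matrix.nonsing_inv_mul _ (isUnit_iff_ne_zero.2 hA), subst_one]

theorem subst_mem_coeffPoly (P : MvPolynomial (Fin n) ℂ) :
    (fun A => subst A P) ∈ coeffPoly ℂ (Matrix (Fin n) (Fin n) ℂ) (Fin n) := by
  induction P using MvPolynomial.induction_on with
  | C a => simpa [subst] using const_mem_coeffPoly (C a)
  | add p q hp hq =>
    simp only [map_add]
    exact (coeffPoly ℂ _ _).add_mem hp hq
  | mul_X p i hp =>
    have h : (fun A : Matrix (Fin n) (Fin n) ℂ => subst A (X i)) ∈ coeffPoly ℂ _ (Fin n) := by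
      let ℓ : Matrix (Fin n) (Fin n) ℂ →ₗ[ℂ] MvPolynomial (Fin n) ℂ :=
        { toFun := fun A => linForm (A i)
          map_add' := fun A B => by simp [linForm, add_mul, Finset.sum_add_distrib]
          map_smul' := fun r A => by
            simp [linForm, Finset.mul_sum, smul_eq_C_mul, mul_assoc] }
      convert linear_mem_coeffPoly ℓ using 2
      simp only [subst, aeval_X]
      rfl
    simp only [map_mul]
    exact (coeffPoly ℂ _ _).mul_mem hp h

theorem det_mem_polyFun {ι : Type*} [Fintype ι] [DecidableEq ι] :
    (fun A : Matrix ι ι ℂ => A.det) ∈ polyFun ℂ (Matrix ι ι ℂ) := by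
  simp only [Matrix.det_apply]
  refine polyFun_sum _ fun σ _ => ?_
  exact (polyFun ℂ _).zsmul_mem (polyFun_prod Finset.univ (f := fun i (A : Matrix ι ι ℂ) => A (σ i) i)
    fun i _ => dual_mem_polyFun (Matrix.entryLinearMap ℂ ℂ (σ i) i)) _

/-- A nonzero space of forms stable under invertible substitutions contains all forms. -/
theorem eq_top_of_substForm_mem {e : ℕ} (S : Submodule ℂ (Form n e))
    (hS : ∀ A : Matrix (Fin n) (Fin n) ℂ, A.det ≠ 0 → ∀ x ∈ S, substForm A e x ∈ S)
    {x : Form n e} (hx : x ∈ S) (hx0 : x ≠ 0) : S = ⊤ := by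
  -- Invertible matrices are Zariski dense, so stability extends to singular ones.
  have hall : ∀ A, substForm A e x ∈ S := fun A => by
    by_contra hA
    obtain ⟨ψ, hψ, hker⟩ := Submodule.exists_le_ker_of_notMem hA
    have hpoly : IsPolyMap ℂ fun A => substForm A e x := isPolyMap_form (subst_mem_coeffPoly x.1)
    refine hψ (eq_zero_of_forall_holdsForGeneral (hpoly ψ) ?_ A)
    rw [holdsForGeneral_iff]
    exact ⟨_, det_mem_polyFun, ⟨1, by simp⟩, fun B hB => hker (hS B hB x hx)⟩
  obtain ⟨v, hv⟩ : ∃ v : Fin n → ℂ, eval v x.1 ≠ 0 := by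
    by_contra! h
    exact hx0 (Subtype.ext (MvPolynomial.funext fun v => by simp [h v]))
  refine eq_top_of_linForm_pow_mem S fun u hu => ?_
  -- This matrix of rank at most one sends `x` to `x(v)` times the `e`-th power of the linear form
  -- of `u`; such powers span.
  have h1 := hall (Matrix.of fun i j => v i * u j)
  have h2 : substForm (Matrix.of fun i j => v i * u j) e x =
      eval v x.1 • (⟨linForm u ^ e, hu⟩ : Form n e) := by
    ext1
    change subst _ x.1 = eval v x.1 • linForm u ^ e
    have h3 : (fun i => linForm ((Matrix.of fun i j => v i * u j) i)) =
        fun i => linForm u * C (v i) := by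
      ext1 i
      simp only [linForm, Matrix.of_apply, Finset.sum_mul, map_mul]
      exact Finset.sum_congr rfl fun j _ => by ring
    have h4 : aeval (fun i => (C (v i) : MvPolynomial (Fin n) ℂ)) x.1 = C (eval v x.1) := by
      refine AlgHom.congr_fun (φ₁ := aeval fun i => (C (v i) : MvPolynomial (Fin n) ℂ))
        (φ₂ := (Algebra.ofId ℂ _).comp (aeval v)) ?_ x.1
      ext1 i
      simp [Algebra.ofId_apply]
    rw [subst, h3, IsHomogeneous.aeval_mul x.2, h4, smul_eq_C_mul, mul_comm]
  rw [h2] at h1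
  exact (S.smul_mem_iff hv).1 h1

end Forms

/-! ### Tangent spaces to the variety of powers. -/

section Tangent

variable {n k : ℕ}

/-- Multiplication by `q ^ d`; its range is the tangent space to the `(d + 1)`-st powers at `q`. -/
noncomputable def mulPow (d : ℕ) (q : Form n k) : Form n k →ₗ[ℂ] Form n (k * (d + 1)) :=
  (LinearMap.mulLeft ℂ ((q : MvPolynomial (Fin n) ℂ) ^ d)).restrict fun _ hP =>
    (IsHomogeneous.pow q.2 d).mul hP

@[simp]
theorem coe_mulPow (d : ℕ) (q h : Form n k) :
    (mulPow d q h : MvPolynomial (Fin n) ℂ) = (q : MvPolynomial (Fin n) ℂ) ^ d * h := rfl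

theorem mulPow_injective (d : ℕ) {q : Form n k} (hq : q ≠ 0) :
    Function.Injective (mulPow d q) := by
  rw [← LinearMap.ker_eq_bot, LinearMap.ker_eq_bot']
  intro h hh
  have h1 := congrArg Subtype.val hh
  rw [coe_mulPow] at h1
  rcases mul_eq_zero.1 h1 with h2 | h2
  · exact absurd (Subtype.ext (eq_zero_of_pow_eq_zero h2)) hq
  · exact Subtype.ext h2

theorem isPolyMap_mulPow {ι : Type*} (d : ℕ) (i : ι) (h : Form n k) :
    IsPolyMap ℂ fun p : ι → Form n k => mulPow d (p i) h := by
  refine isPolyMap_form ?_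
  have h1 : (fun p : ι → Form n k => (p i : MvPolynomial (Fin n) ℂ)) ∈ coeffPoly ℂ _ (Fin n) :=
    linear_mem_coeffPoly ((Form n k).subtype ∘ₗ
      (LinearMap.proj i : (ι → Form n k) →ₗ[ℂ] Form n k))
  exact (coeffPoly ℂ _ _).mul_mem ((coeffPoly ℂ _ _).pow_mem h1 d) (const_mem_coeffPoly h.1)

/-- The tangent space to the variety of `(d + 1)`-st powers at `q ^ (d + 1)`. -/
noncomputable def powTangent (d : ℕ) (q : Form n k) : Submodule ℂ (Form n (k * (d + 1))) :=
  LinearMap.range (mulPow d q)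

theorem iSup_powTangent_eq_span {ι : Type*} (d : ℕ) (p : ι → Form n k) :
    (⨆ i, powTangent d (p i)) = Submodule.span ℂ (Set.range
      fun x : ι × Fin (finrank ℂ (Form n k)) => mulPow d (p x.1) (finBasis ℂ (Form n k) x.2)) := by
  have h : ∀ i, powTangent d (p i) = Submodule.span ℂ (Set.range
      fun b => mulPow d (p i) (finBasis ℂ (Form n k) b)) := fun i => by
    rw [powTangent, LinearMap.range_eq_map, ← (finBasis ℂ (Form n k)).span_eq, Submodule.map_span,
      ← Set.range_comp]
    rfl
  simp only [h]
  rw [← Submodule.span_iUnion]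
  congr 1
  ext x
  simp

theorem holdsForGeneral_le_finrank_mulPow (d j r : ℕ)
    (h : ∃ p : Fin j → Form n k, r ≤ finrank ℂ ↥(⨆ i, powTangent d (p i))) :
    HoldsForGeneral ℂ fun p : Fin j → Form n k =>
      r ≤ finrank ℂ ↥(⨆ i, powTangent d (p i)) := by
  obtain ⟨p, hp⟩ := h
  have h : (fun p : Fin j → Form n k => r ≤ finrank ℂ ↥(⨆ i, powTangent d (p i))) = fun p =>
      r ≤ finrank ℂ (Submodule.span ℂ (Set.range fun x : Fin j × Fin (finrank ℂ (Form n k)) =>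
        mulPow d (p x.1) (finBasis ℂ (Form n k) x.2))) := by
    ext1 p
    rw [iSup_powTangent_eq_span]
  rw [h]
  rw [iSup_powTangent_eq_span] at hp
  exact holdsForGeneral_le_finrank_span
    (g := fun (x : Fin j × Fin (finrank ℂ (Form n k))) (p : Fin j → Form n k) =>
      mulPow d (p x.1) (finBasis ℂ (Form n k) x.2))
    (fun x => isPolyMap_mulPow d x.1 _) hp

/-- A substitution is a ring homomorphism, so it carries the tangent space at `q` into the one at
the substituted form. -/
theorem substForm_mem_iSup {d : ℕ} {ι : Type*} {A : Matrix (Fin n) (Fin n) ℂ}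
    {p : ι → Form n k} {x : Form n (k * (d + 1))}
    (hx : x ∈ ⨆ i, powTangent d (p i)) :
    substForm A _ x ∈ ⨆ i, powTangent d (substForm A k (p i)) := by
  have h := Submodule.mem_map_of_mem (f := substForm A _) hx
  rw [Submodule.map_iSup] at h
  refine (iSup_mono fun i => ?_ : _ ≤ ⨆ i, powTangent d (substForm A k (p i))) h
  rintro _ ⟨_, ⟨y, rfl⟩, rfl⟩
  refine ⟨substForm A k y, Subtype.ext ?_⟩
  change subst A (p i) ^ d * subst A y = subst A ((p i : MvPolynomial (Fin n) ℂ) ^ d * y)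
  rw [map_mul, map_pow]

/-- The forms lying in the sum for general `p` constitute a subspace. It is stable under an
invertible `A`, because substituting `A⁻¹` in a general tuple gives a general tuple. Irreducibility
then applies. -/
theorem holdsForGeneral_mem_iSup {d j : ℕ} {x : Form n (k * (d + 1))} (hx0 : x ≠ 0)
    (hx : HoldsForGeneral ℂ fun p : Fin j → Form n k =>
      x ∈ ⨆ i, powTangent d (p i)) (y : Form n (k * (d + 1))) :
    HoldsForGeneral ℂ fun p : Fin j → Form n k => y ∈ ⨆ i, powTangent d (p i) := by
  let S : Submodule ℂ (Form n (k * (d + 1))) :=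
    { carrier := {x | HoldsForGeneral ℂ fun p : Fin j → Form n k =>
        x ∈ ⨆ i, powTangent d (p i)}
      zero_mem' := holdsForGeneral_of_forall fun p => Submodule.zero_mem _
      add_mem' := fun ha hb => (ha.and hb).mono fun p hp => Submodule.add_mem _ hp.1 hp.2
      smul_mem' := fun c a ha => ha.mono fun p hp => Submodule.smul_mem _ c hp }
  have hS : S = ⊤ := by
    refine eq_top_of_substForm_mem S (fun A hA x hx => ?_) (show x ∈ S from hx) hx0
    let ℓ : (Fin j → Form n k) →ₗ[ℂ] (Fin j → Form n k) :=
      LinearMap.pi fun i => substForm A⁻¹ k ∘ₗ LinearMap.proj i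
    have hℓ : Function.Surjective ℓ := fun p => by
      refine ⟨fun i => substForm A k (p i), ?_⟩
      ext1 i
      have h := substForm_inv A⁻¹ (by
        rw [Matrix.det_nonsing_inv]
        simpa [Ring.inverse_eq_inv'] using hA) k (p i)
      rwa [Matrix.nonsing_inv_nonsing_inv A (isUnit_iff_ne_zero.2 hA)] at h
    refine (HoldsForGeneral.comp_surjective hx hℓ).mono fun p hp => ?_
    have h := substForm_mem_iSup (A := A) hp
    have h2 : ∀ i, substForm A k (ℓ p i) = p i := fun i => substForm_inv A hA k (p i)
    simpa only [h2] using h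
  have : y ∈ S := hS ▸ Submodule.mem_top
  exact this

theorem form_nontrivial (hn : 0 < n) (k : ℕ) : ∃ q : Form n k, q ≠ 0 := by
  refine ⟨⟨X ⟨0, hn⟩ ^ k, isHomogeneous_X_pow _ _⟩, fun h => ?_⟩
  exact pow_ne_zero k (X_ne_zero (R := ℂ) (⟨0, hn⟩ : Fin n)) (congrArg Subtype.val h)

theorem dimForm_pos (hn : 0 < n) (k : ℕ) : 0 < dimForm n k := by
  obtain ⟨q, hq⟩ := form_nontrivial hn k
  have : Nontrivial (Form n k) := ⟨q, 0, hq⟩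
  exact finrank_pos

/-- The tangent spaces at `m` general points are independent. -/
theorem holdsForGeneral_finrank_mulPow (hn : 0 < n) {d m : ℕ}
    (hm : m * dimForm n k + dimForm n k ^ 2 ≤ dimForm n (k * (d + 1))) :
    HoldsForGeneral ℂ fun p : Fin m → Form n k =>
      finrank ℂ ↥(⨆ i, powTangent d (p i)) = m * dimForm n k := by
  obtain ⟨w, hw⟩ := exists_generic_finrank
    (T := powTangent (n := n) (k := k) d) (holdsForGeneral_le_finrank_mulPow d)
  have hw1 : w 1 = dimForm n k := by
    have h1 : HoldsForGeneral ℂ fun p : Fin 1 → Form n k =>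
        dimForm n k ≤ finrank ℂ ↥(⨆ i, powTangent d (p i)) := by
      refine holdsForGeneral_le_finrank_mulPow d 1 _ ?_
      obtain ⟨q, hq⟩ := form_nontrivial hn k
      refine ⟨fun _ => q, ?_⟩
      rw [ciSup_const, powTangent, LinearMap.finrank_range_of_inj (mulPow_injective d hq)]
      rfl
    obtain ⟨p, hp, hp'⟩ := (h1.and (hw 1)).exists
    rw [← hp']
    refine le_antisymm ?_ hp
    rw [iSup_unique]
    exact LinearMap.finrank_range_le _
  refine (hw m).mono fun p hp => ?_
  rw [hp, ← hw1]
  refine generic_finrank_eq_mul hw (fun j x hx0 hx y => holdsForGeneral_mem_iSup hx0 hx y)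
    (hw1 ▸ dimForm_pos hn k) ?_
  rw [hw1]
  exact hm

theorem homogeneousComponent_mul_of_isHomogeneous {P Q : MvPolynomial (Fin n) ℂ} {a b : ℕ}
    (hQ : Q.IsHomogeneous b) :
    homogeneousComponent (a + b) (Q * P) = Q * homogeneousComponent a P := by
  have h : ∀ i, homogeneousComponent (a + b) (Q * homogeneousComponent i P) =
      if i = a then Q * homogeneousComponent a P else 0 := fun i => by
    rw [homogeneousComponent_of_mem
      (hQ.mul (homogeneousComponent_isHomogeneous i P) : _ ∈ homogeneousSubmodule _ _ _)]
    by_cases hia : i = a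
    · rw [if_pos (by omega), if_pos hia, hia]
    · rw [if_neg (by omega), if_neg hia]
  conv_lhs => rw [← sum_homogeneousComponent P, Finset.mul_sum, map_sum]
  simp only [h, Finset.sum_ite_eq', Finset.mem_range]
  split_ifs with h1
  · rfl
  · rw [homogeneousComponent_eq_zero _ _ (by omega), mul_zero]

/-- In a combination ∑ c_i p_i^d of degree k(d+1), only the degree-k components of the c_i matter.
-/
theorem idealPart_eq_map {m : ℕ} (d : ℕ) (p : Fin m → Form n k) :
    idealPart (fun i => (p i : MvPolynomial (Fin n) ℂ) ^ d) (k * (d + 1)) =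
      (⨆ i, powTangent d (p i)).map (Form n (k * (d + 1))).subtype := by
  apply le_antisymm
  · rintro x ⟨hx, hx'⟩
    obtain ⟨c, rfl⟩ := (Ideal.mem_span_range_iff_exists_fun).1 hx
    rw [← homogeneousComponent_eq_self hx', map_sum]
    refine Submodule.sum_mem _ fun i _ => ?_
    have h1 : homogeneousComponent (k * (d + 1)) (c i * (p i : MvPolynomial (Fin n) ℂ) ^ d) =
        (p i : MvPolynomial (Fin n) ℂ) ^ d * homogeneousComponent k (c i) := by
      rw [mul_comm (c i), show k * (d + 1) = k + k * d by ring]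
      exact homogeneousComponent_mul_of_isHomogeneous (IsHomogeneous.pow (p i).2 d)
    rw [h1]
    exact ⟨mulPow d (p i) ⟨_, homogeneousComponent_isHomogeneous k (c i)⟩,
      Submodule.mem_iSup_of_mem i ⟨_, rfl⟩, rfl⟩
  · rw [Submodule.map_iSup]
    refine iSup_le fun i => ?_
    rintro _ ⟨_, ⟨h, rfl⟩, rfl⟩
    refine ⟨?_, (mulPow d (p i) h).2⟩
    exact Ideal.mul_mem_right _ _ (Ideal.subset_span ⟨i, rfl⟩)

/-- The differential of `q ↦ ∑ i, q i ^ (d + 1)` at `p`, up to the factor `d + 1`. -/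
noncomputable def sumMulPow {ι : Type*} [Fintype ι] (d : ℕ) (p : ι → Form n k) :
    (ι → Form n k) →ₗ[ℂ] Form n (k * (d + 1)) :=
  ∑ i, mulPow d (p i) ∘ₗ LinearMap.proj i

theorem sumMulPow_apply {ι : Type*} [Fintype ι] (d : ℕ) (p h : ι → Form n k) :
    sumMulPow d p h = ∑ i, mulPow d (p i) (h i) := by
  simp [sumMulPow]

/-- The source has dimension `m * dimForm n k`, and the range contains every tangent space, so
rank-nullity leaves no kernel. -/
theorem sumMulPow_injective {m : ℕ} {d : ℕ} {p : Fin m → Form n k}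
    (hp : finrank ℂ ↥(⨆ i, powTangent d (p i)) = m * dimForm n k) :
    Function.Injective (sumMulPow d p) := by
  have h1 : (⨆ i, powTangent d (p i)) ≤ LinearMap.range (sumMulPow d p) := by
    refine iSup_le fun i => ?_
    rintro _ ⟨h, rfl⟩
    refine ⟨Pi.single i h, ?_⟩
    rw [sumMulPow_apply, Finset.sum_eq_single i]
    · simp
    · intro j _ hj
      simp [hj]
    · simp
  have h2 := Submodule.finrank_mono h1
  have h3 := LinearMap.finrank_range_add_finrank_ker (sumMulPow d p)
  have h4 : finrank ℂ (Fin m → Form n k) = m * dimForm n k := by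
    rw [finrank_pi_fintype]
    simp [dimForm]
  rw [← LinearMap.ker_eq_bot, ← Submodule.finrank_eq_zero]
  omega

end Tangent

/-! ### The Jacobian criterion for algebraic independence. -/

section Jacobian

theorem pderiv_aeval {ι κ R : Type*} [CommRing R] [Fintype ι] (g : ι → MvPolynomial κ R) (b : κ)
    (G : MvPolynomial ι R) :
    pderiv b (aeval g G) = ∑ a, aeval g (pderiv a G) * pderiv b (g a) := by
  classical
  induction G using MvPolynomial.induction_on with
  | C r => simp [algebraMap_eq]
  | add p q hp hq => simp only [map_add, hp, hq, add_mul, Finset.sum_add_distrib]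
  | mul_X p i hp =>
    simp only [map_mul, aeval_X, Derivation.leibniz, hp, smul_eq_mul, map_add, add_mul,
      Finset.sum_add_distrib, pderiv_X, Finset.mul_sum]
    congr 1
    · rw [Finset.sum_eq_single i]
      · simp
      · intro j _ hj
        simp [hj.symm]
      · simp
    · exact Finset.sum_congr rfl fun a _ => by ring

theorem totalDegree_pderiv_le {ι R : Type*} [CommRing R] {N : ℕ} {G : MvPolynomial ι R}
    (hG : G.totalDegree ≤ N + 1) (i : ι) : (pderiv i G).totalDegree ≤ N := by
  classical
  refine Finset.sup_le fun m hm => ?_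
  rw [MvPolynomial.mem_support_iff, coeff_pderiv] at hm
  have h := (le_totalDegree (MvPolynomial.mem_support_iff.2 (left_ne_zero_of_mul hm))).trans hG
  rw [Finsupp.sum_add_index' (by simp) (by simp), Finsupp.sum_single_index rfl] at h
  omega

theorem eq_C_of_pderiv_eq_zero {ι K : Type*} [Field K] [CharZero K] {G : MvPolynomial ι K}
    (hG : ∀ i, pderiv i G = 0) : G = C (coeff 0 G) := by
  classical
  ext m
  rw [coeff_C]
  split_ifs with hm
  · rw [hm]
  · obtain ⟨i, hi⟩ : ∃ i, m i ≠ 0 := by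
      by_contra! h
      exact hm (Finsupp.ext fun i => by simp [h i])
    have h := coeff_pderiv (i := i) G (m - Finsupp.single i 1)
    have hle : Finsupp.single i 1 ≤ m := by
      rw [Finsupp.single_le_iff]
      omega
    rw [hG, coeff_zero, tsub_add_cancel_of_le hle] at h
    rcases mul_eq_zero.1 h.symm with h | h
    · exact h
    · exact absurd h (by norm_cast)

/-- The Jacobian criterion for algebraic independence. -/
theorem algebraicIndependent_of_pderiv {ι K : Type*} [Field K] [CharZero K] [Fintype ι]
    [DecidableEq ι] {g : ι → MvPolynomial ι K} {c : ι → K}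
    (hg : ∀ a b, eval c (pderiv b (g a)) = if a = b then 1 else 0) :
    AlgebraicIndependent K g := by
  rw [algebraicIndependent_iff]
  let M : Matrix ι ι (MvPolynomial ι K) := Matrix.of fun a b => pderiv b (g a)
  have hM : M.det ≠ 0 := by
    intro h
    have h1 : (eval c) M.det = 1 := by
      rw [RingHom.map_det]
      have h2 : (eval c).mapMatrix M = 1 := by
        ext a b
        simp [M, hg, Matrix.one_apply]
      rw [h2, Matrix.det_one]
    rw [h, map_zero] at h1
    exact zero_ne_one h1
  -- Differentiating the relation gives a vector killed by the nonsingular Jacobian matrix. The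
  -- partial derivatives of `G` are thus relations too, of lower degree.
  have key : ∀ G : MvPolynomial ι K, aeval g G = 0 → ∀ a, aeval g (pderiv a G) = 0 := by
    intro G hG a
    refine congrFun (Matrix.eq_zero_of_vecMul_eq_zero (M := M) hM
      (v := fun a => aeval g (pderiv a G)) ?_) a
    ext1 b
    have h := pderiv_aeval g b G
    rw [hG, map_zero] at h
    exact h.symm
  have hC : ∀ G : MvPolynomial ι K, (∀ i, pderiv i G = 0) → aeval g G = 0 → G = 0 := by
    intro G hG h
    rw [eq_C_of_pderiv_eq_zero hG, aeval_C, algebraMap_eq, C_eq_zero] at h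
    rw [eq_C_of_pderiv_eq_zero hG, h, map_zero]
  have main : ∀ N : ℕ, ∀ G : MvPolynomial ι K, G.totalDegree ≤ N → aeval g G = 0 → G = 0 := by
    intro N
    induction N with
    | zero =>
      intro G hN hG
      refine hC G (fun i => ?_) hG
      rw [(totalDegree_eq_zero_iff_eq_C).1 (Nat.le_zero.1 hN), pderiv_C]
    | succ N ih =>
      intro G hN hG
      exact hC G (fun i => ih _ (totalDegree_pderiv_le hN i) (key G hG i)) hG
  exact fun G => main _ G le_rfl

end Jacobian

/-! ### Transcendence degree modulo a prime. -/

section IndepMod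

variable {K R : Type*} [Field K] [CommRing R] [Algebra K R]

/-- There are `r` elements algebraically independent modulo `P`. -/
def IndepMod (K : Type*) {R : Type*} [Field K] [CommRing R] [Algebra K R] (P : Ideal R) (r : ℕ) :
    Prop :=
  ∃ x : Fin r → R, AlgebraicIndependent K fun i => Ideal.Quotient.mk P (x i)

theorem indepMod_zero {P : Ideal R} (hP : P ≠ ⊤) : IndepMod K P 0 := by
  have : Nontrivial (R ⧸ P) := Ideal.Quotient.nontrivial_iff.2 hP
  exact ⟨Fin.elim0, algebraicIndependent_empty_type_iff.2 (algebraMap K (R ⧸ P)).injective⟩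

/-- The transcendence degree increases when passing to a smaller prime. -/
theorem IndepMod.succ_of_lt {P Q : Ideal R} [hP : P.IsPrime] (hPQ : P < Q) {r : ℕ}
    (h : IndepMod K Q r) : IndepMod K P (r + 1) := by
  obtain ⟨x, hx⟩ := h
  obtain ⟨f, hfQ, hfP⟩ := SetLike.exists_of_lt hPQ
  let π : R ⧸ P →ₐ[K] R ⧸ Q := Ideal.Quotient.factorₐ K hPQ.le
  have hxP : AlgebraicIndependent K fun i => Ideal.Quotient.mk P (x i) :=
    AlgebraicIndependent.of_comp π hx
  have hf0 : Ideal.Quotient.mk P f ≠ 0 := fun h => hfP (Ideal.Quotient.eq_zero_iff_mem.1 h)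
  -- An algebraic relation for `f` can be chosen with nonzero constant coefficient. Modulo `Q`,
  -- where `f` vanishes, that coefficient becomes a relation between the `x i`.
  have htr : Transcendental (Algebra.adjoin K (Set.range fun i => Ideal.Quotient.mk P (x i)))
      (Ideal.Quotient.mk P f) := by
    intro halg
    obtain ⟨q, hq0, hq⟩ := halg.exists_nonzero_coeff_and_aeval_eq_zero
      (mem_nonZeroDivisors_of_ne_zero hf0)
    obtain ⟨G, hG⟩ : ∃ G : MvPolynomial (Fin r) K,
        aeval (fun i => Ideal.Quotient.mk P (x i)) G = (q.coeff 0 : R ⧸ P) := by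
      have h := Algebra.adjoin_range_eq_range_aeval K fun i => Ideal.Quotient.mk P (x i)
      exact h.le (q.coeff 0).2
    have h1 : π (q.coeff 0 : R ⧸ P) = 0 := by
      have h2 := congrArg π hq
      rw [← Polynomial.divX_mul_X_add q] at h2
      have h3 : π (Ideal.Quotient.mk P f) = 0 := Ideal.Quotient.eq_zero_iff_mem.2 hfQ
      simp only [map_add, map_mul, Polynomial.aeval_X, Polynomial.aeval_C, h3, mul_zero, zero_add,
        map_zero] at h2
      exact h2
    have h4 : aeval (fun i => Ideal.Quotient.mk Q (x i)) G = 0 := by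
      rw [← hG, ← AlgHom.comp_apply, comp_aeval] at h1
      exact h1
    have h5 := (algebraicIndependent_iff.1 hx) G h4
    rw [h5, map_zero] at hG
    exact hq0 (Subtype.ext hG.symm)
  have h := (hxP.option_iff_transcendental _).2 htr
  have h' := h.comp (finSuccEquiv' (Fin.last r)) (Equiv.injective _)
  refine ⟨fun i => ((finSuccEquiv' (Fin.last r)) i).elim f x, ?_⟩
  convert h' using 2 with i
  simp only [Function.comp_apply]
  cases finSuccEquiv' (Fin.last r) i <;> rfl

/-- The quotient by the kernel embeds in a polynomial ring of transcendence degree `s`. -/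
theorem IndepMod.le_of_ker {s r : ℕ} (θ : R →ₐ[K] MvPolynomial (Fin s) K)
    (h : IndepMod K (RingHom.ker θ) r) : r ≤ s := by
  obtain ⟨x, hx⟩ := h
  have h1 := hx.map' (f := Ideal.kerLiftAlg θ) (Ideal.kerLiftAlg_injective θ)
  have h2 := h1.lift_cardinalMk_le_trdeg
  rw [MvPolynomial.trdeg_of_isDomain] at h2
  simpa using h2

theorem indepMod_of_ker {s r : ℕ} (θ : R →ₐ[K] MvPolynomial (Fin s) K) (x : Fin r → R)
    (hx : AlgebraicIndependent K fun i => θ (x i)) : IndepMod K (RingHom.ker θ) r :=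
  ⟨x, AlgebraicIndependent.of_comp (Ideal.kerLiftAlg θ) hx⟩

end IndepMod

open TopologicalSpace

/-! ### Krull dimension of an irreducible closed set as a height. -/

section KrullDim

variable {X : Type*} [TopologicalSpace X]

/-- The dimension of an irreducible closed subset is its height among irreducible closed sets. -/
theorem topologicalKrullDim_eq_height (Z : IrreducibleCloseds X) :
    topologicalKrullDim (Z : Set X) = (Order.height Z : WithBot ℕ∞) := by
  rw [Order.height_eq_krullDim_Iic]
  apply le_antisymm
  · have hsub : Topology.IsInducing (Subtype.val : ↥(Z : Set X) → X) := .subtypeVal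
    refine Order.krullDim_le_of_strictMono
      (fun Y => ⟨IrreducibleCloseds.map _ hsub.continuous Y, ?_⟩)
      fun Y Y' h => IrreducibleCloseds.map_strictMono_of_isInducing hsub h
    change closure _ ⊆ (Z : Set X)
    refine closure_minimal ?_ Z.isClosed
    rintro _ ⟨y, _, rfl⟩
    exact y.2
  · have himage : ∀ Y : Set.Iic Z, Subtype.val '' (Subtype.val ⁻¹' (Y.1 : Set X) : Set (Z : Set X)) =
        (Y.1 : Set X) := fun Y => by
      rw [Subtype.image_preimage_coe]
      exact Set.inter_eq_right.2 Y.2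
    have hirr : ∀ Y : Set.Iic Z,
        IsIrreducible (Subtype.val ⁻¹' (Y.1 : Set X) : Set (Z : Set X)) := fun Y => by
      obtain ⟨⟨y, hy⟩, hpre⟩ := Y.1.isIrreducible
      refine ⟨⟨⟨y, Y.2 hy⟩, hy⟩, ?_⟩
      rintro _ _ ⟨U, hU, rfl⟩ ⟨V, hV, rfl⟩ ⟨u, hu, hu'⟩ ⟨v, hv, hv'⟩
      obtain ⟨w, hw, hw'⟩ := hpre U V hU hV ⟨u, hu, hu'⟩ ⟨v, hv, hv'⟩
      exact ⟨⟨w, Y.2 hw⟩, hw, hw'⟩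
    refine Order.krullDim_le_of_strictMono
      (fun Y => ⟨Subtype.val ⁻¹' (Y.1 : Set X), hirr Y, Y.1.isClosed.preimage continuous_subtype_val⟩)
      (Monotone.strictMono_of_injective (fun Y Y' h x hx => h hx) fun Y Y' h => ?_)
    have h1 := congrArg (fun W : IrreducibleCloseds (Z : Set X) =>
      Subtype.val '' (W : Set (Z : Set X))) h
    refine Subtype.ext (IrreducibleCloseds.ext ?_)
    rw [← himage Y, ← himage Y']
    exact h1

end KrullDim

/-! ### Cone ideals of projective sets and the upper bound on dimension. -/

section ConeIdeal

variable {K V : Type*} [Field K] [AddCommGroup V] [Module K V]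

attribute [local instance] projZariski

theorem isClosed_iff_exists_projZeroLocus {Z : Set (Projectivization K V)} :
    IsClosed Z ↔ ∃ S : Set (MvPolynomial (Module.Dual K V) K),
      (∀ F ∈ S, ∃ e : ℕ, F.IsHomogeneous e) ∧ Z = projZeroLocus S := by
  rw [← isOpen_compl_iff]
  change Zᶜᶜ ∈ _ ↔ _
  rw [compl_compl]
  rfl

theorem evalAt_smul {F : MvPolynomial (Module.Dual K V) K} {e : ℕ} (hF : F.IsHomogeneous e)
    (t : K) (v : V) : evalAt (t • v) F = t ^ e * evalAt v F := by
  have h := IsHomogeneous.aeval_mul hF t fun φ => φ v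
  simp only [aeval_eq_eval] at h
  simpa [evalAt] using h

theorem isPolyMap_smul_const (v : V) : IsPolyMap K fun t : K => t • v :=
  LinearMap.isPolyMap (LinearMap.toSpanSingleton K V v)

/-- The zero locus in projective space of all homogeneous components of `F`. -/
def componentLocus (F : MvPolynomial (Module.Dual K V) K) : Set (Projectivization K V) :=
  projZeroLocus (Set.range fun i => homogeneousComponent i F)

theorem isClosed_componentLocus (F : MvPolynomial (Module.Dual K V) K) :
    IsClosed (componentLocus F) := by
  rw [isClosed_iff_exists_projZeroLocus]
  refine ⟨_, ?_, rfl⟩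
  rintro _ ⟨i, rfl⟩
  exact ⟨i, homogeneousComponent_isHomogeneous i F⟩

theorem mem_componentLocus [Infinite K] {F : MvPolynomial (Module.Dual K V) K}
    {x : Projectivization K V} : x ∈ componentLocus F ↔ ∀ t : K, evalAt (t • x.rep) F = 0 := by
  have hsum : ∀ t : K, evalAt (t • x.rep) F = ∑ i ∈ Finset.range (F.totalDegree + 1),
      t ^ i * evalAt x.rep (homogeneousComponent i F) := fun t => by
    conv_lhs => rw [← sum_homogeneousComponent F, evalAt, map_sum]
    exact Finset.sum_congr rfl fun i _ => evalAt_smul (homogeneousComponent_isHomogeneous i F) t _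
  constructor
  · intro hx t
    rw [hsum]
    refine Finset.sum_eq_zero fun i _ => ?_
    rw [hx _ ⟨i, rfl⟩, mul_zero]
  · rintro hx _ ⟨i, rfl⟩
    let P : Polynomial K := ∑ i ∈ Finset.range (F.totalDegree + 1),
      Polynomial.monomial i (evalAt x.rep (homogeneousComponent i F))
    have hP : P = 0 := Polynomial.funext fun t => by
      rw [Polynomial.eval_zero, ← hx t, hsum, Polynomial.eval_finsetSum]
      exact Finset.sum_congr rfl fun i _ => by rw [Polynomial.eval_monomial, mul_comm]
    by_cases hi : i < F.totalDegree + 1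
    · have h1 : P.coeff i = evalAt x.rep (homogeneousComponent i F) := by
        simp only [P, Polynomial.finsetSum_coeff, Polynomial.coeff_monomial]
        rw [Finset.sum_ite_eq', if_pos (Finset.mem_range.2 hi)]
      change evalAt x.rep (homogeneousComponent i F) = 0
      rw [← h1, hP, Polynomial.coeff_zero]
    · change evalAt x.rep (homogeneousComponent i F) = 0
      rw [homogeneousComponent_eq_zero _ _ (by omega)]
      simp [evalAt]

theorem mk_mem_componentLocus [Infinite K] {F : MvPolynomial (Module.Dual K V) K} {v : V}
    (hv : v ≠ 0) : Projectivization.mk K v hv ∈ componentLocus F ↔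
      ∀ t : K, evalAt (t • v) F = 0 := by
  obtain ⟨a, ha⟩ := Projectivization.exists_smul_eq_mk_rep K v hv
  rw [mem_componentLocus, ← ha]
  constructor
  · intro h t
    have := h (t * (a⁻¹ : Kˣ))
    rwa [Units.smul_def, smul_smul, mul_assoc, Units.inv_mul, mul_one] at this
  · intro h t
    rw [Units.smul_def, smul_smul]
    exact h _

/-- The ideal of the polynomials vanishing on the cone over `Y`. -/
def coneIdeal [Infinite K] (Y : Set (Projectivization K V)) :
    Ideal (MvPolynomial (Module.Dual K V) K) where
  carrier := {F | Y ⊆ componentLocus F}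
  zero_mem' x _ := mem_componentLocus.2 fun t => by simp [evalAt]
  add_mem' {F G} hF hG x hx := mem_componentLocus.2 fun t => by
    have h1 := mem_componentLocus.1 (hF hx) t
    have h2 := mem_componentLocus.1 (hG hx) t
    rw [evalAt] at *
    rw [map_add, h1, h2, add_zero]
  smul_mem' F G hG x hx := mem_componentLocus.2 fun t => by
    have h2 := mem_componentLocus.1 (hG hx) t
    rw [evalAt] at *
    rw [smul_eq_mul, map_mul, h2, mul_zero]

variable [Infinite K]

theorem mem_coneIdeal {Y : Set (Projectivization K V)} {F : MvPolynomial (Module.Dual K V) K} :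
    F ∈ coneIdeal Y ↔ Y ⊆ componentLocus F := Iff.rfl

theorem coneIdeal_closure (Y : Set (Projectivization K V)) :
    coneIdeal (closure Y) = coneIdeal Y := by
  ext F
  simp only [mem_coneIdeal]
  exact (isClosed_componentLocus F).closure_subset_iff

theorem coneIdeal_isPrime {Y : Set (Projectivization K V)} (hY : IsIrreducible Y) :
    (coneIdeal Y).IsPrime := by
  refine ⟨fun h => ?_, fun {F G} hFG => ?_⟩
  · obtain ⟨y, hy⟩ := hY.nonempty
    have h1 : (1 : MvPolynomial (Module.Dual K V) K) ∈ coneIdeal Y := h ▸ Submodule.mem_top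
    have := mem_componentLocus.1 (h1 hy) 0
    simp [evalAt] at this
  · by_contra! hcon
    obtain ⟨hF, hG⟩ := hcon
    rw [mem_coneIdeal, Set.not_subset] at hF hG
    obtain ⟨y, hy, hyF, hyG⟩ := hY.isPreirreducible _ _ (isClosed_componentLocus F).isOpen_compl
      (isClosed_componentLocus G).isOpen_compl hF hG
    rw [Set.mem_compl_iff, mem_componentLocus, not_forall] at hyF hyG
    obtain ⟨a, ha⟩ := hyF
    obtain ⟨b, hb⟩ := hyG
    -- Both polynomials are nonzero somewhere on the line through `y.rep`, hence at a common point
    -- of it.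
    obtain ⟨t, htF, htG⟩ := exists_ne_zero_and_ne_zero
      (polyFun_comp (evalAt_mem_polyFun F) (isPolyMap_smul_const y.rep))
      (polyFun_comp (evalAt_mem_polyFun G) (isPolyMap_smul_const y.rep)) ha hb
    refine mul_ne_zero htF htG ?_
    have h1 := mem_componentLocus.1 (hFG hy) t
    rwa [evalAt, map_mul] at h1

theorem subset_of_coneIdeal_le {Y Y' : Set (Projectivization K V)} (hY : IsClosed Y)
    (h : coneIdeal Y ≤ coneIdeal Y') : Y' ⊆ Y := by
  obtain ⟨S, hS, rfl⟩ := isClosed_iff_exists_projZeroLocus.1 hY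
  intro y hy F hF
  have h1 : F ∈ coneIdeal (projZeroLocus S) := fun x hx => mem_componentLocus.2 fun t => by
    obtain ⟨e, he⟩ := hS F hF
    rw [evalAt_smul he, hx F hF, mul_zero]
  simpa using mem_componentLocus.1 (h h1 hy) 1

theorem coneIdeal_lt_of_lt {Y Y' : IrreducibleCloseds (Projectivization K V)} (h : Y' < Y) :
    coneIdeal (Y : Set (Projectivization K V)) < coneIdeal (Y' : Set (Projectivization K V)) := by
  refine lt_of_le_not_ge (fun F hF => Set.Subset.trans h.le hF) fun hle => ?_
  exact h.not_ge (subset_of_coneIdeal_le Y'.isClosed hle)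

/-- The ideal of the origin lies strictly above every cone ideal. This extra step accounts for the
difference of one between affine and projective dimension. -/
theorem exists_coneIdeal_lt {Y : Set (Projectivization K V)} (hY : Y.Nonempty) :
    ∃ Q : Ideal (MvPolynomial (Module.Dual K V) K), Q ≠ ⊤ ∧ coneIdeal Y < Q := by
  obtain ⟨y, hy⟩ := hY
  refine ⟨RingHom.ker (eval fun φ : Module.Dual K V => φ 0), RingHom.ker_ne_top _,
    lt_of_le_not_ge (fun F hF => ?_) fun h => ?_⟩
  · have := mem_componentLocus.1 (hF hy) 0
    rwa [zero_smul] at this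
  · obtain ⟨ψ, hψ⟩ :=
    not_forall.1 (mt (Module.forall_dual_apply_eq_zero_iff K y.rep).1 y.rep_nonzero)
    have h1 : X ψ ∈ coneIdeal Y := h (by simp [RingHom.mem_ker])
    have := mem_componentLocus.1 (h1 hy) 1
    rw [one_smul, evalAt, eval_X] at this
    exact hψ this

/-- The dimension of an irreducible closed set is bounded by the transcendence degree of its
homogeneous coordinate ring minus one. -/
theorem height_le_of_indepMod (s : ℕ) (Y : IrreducibleCloseds (Projectivization K V))
    (hY : ∀ r, IndepMod K (coneIdeal (Y : Set (Projectivization K V))) r → r ≤ s + 1) :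
    Order.height Y ≤ s := by
  induction s generalizing Y with
  | zero =>
    rw [Order.height_le_coe_iff]
    intro Y' h
    exfalso
    obtain ⟨Q, hQ, hlt⟩ := exists_coneIdeal_lt Y'.isIrreducible.nonempty
    have := coneIdeal_isPrime Y.isIrreducible
    have := coneIdeal_isPrime Y'.isIrreducible
    -- Two strict inclusions below the ideal of the origin would give two independent elements, but
    -- at most one is allowed.
    have := hY _ (((indepMod_zero hQ).succ_of_lt hlt).succ_of_lt (coneIdeal_lt_of_lt h))
    omega
  | succ s ih =>
    rw [Order.height_le_coe_iff]
    intro Y' h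
    refine (ih Y' fun r hr => ?_).trans_lt (by exact_mod_cast Nat.lt_succ_self s)
    have := coneIdeal_isPrime Y.isIrreducible
    have := hY _ (hr.succ_of_lt (coneIdeal_lt_of_lt h))
    omega

/-! ### Projective images of polynomial maps. -/

section Image

variable {E : Type*} [AddCommGroup E] [Module K E] {φ : E → V}

/-- The image in projective space of a map to a vector space. -/
def projImage (K : Type*) {V E : Type*} [Field K] [AddCommGroup V] [Module K V] (φ : E → V) :
    Set (Projectivization K V) :=
  {x | ∃ (q : E) (hq : φ q ≠ 0), x = Projectivization.mk K (φ q) hq}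

/-- Each open set meeting the image pulls back to a condition satisfied by general parameters, and
two such conditions have a common solution. -/
theorem isIrreducible_projImage (hφ : IsPolyMap K φ) (hne : ∃ q, φ q ≠ 0) :
    IsIrreducible (projImage K φ) := by
  obtain ⟨q₀, hq₀⟩ := hne
  refine ⟨⟨_, q₀, hq₀, rfl⟩, ?_⟩
  have key : ∀ U : Set (Projectivization K V), IsOpen U → (projImage K φ ∩ U).Nonempty →
      HoldsForGeneral K fun q => ∀ hq : φ q ≠ 0, Projectivization.mk K (φ q) hq ∈ U := by
    rintro U hU ⟨_, ⟨q, hq, rfl⟩, hqU⟩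
    obtain ⟨S, hS, hUS⟩ := isClosed_iff_exists_projZeroLocus.1 hU.isClosed_compl
    have h1 : ∃ F ∈ S, evalAt (φ q) F ≠ 0 := by
      by_contra! h
      have h2 : Projectivization.mk K (φ q) hq ∈ Uᶜ := by
        rw [hUS]
        intro F hF
        obtain ⟨e, he⟩ := hS F hF
        obtain ⟨a, ha⟩ := Projectivization.exists_smul_eq_mk_rep K (φ q) hq
        rw [← ha, Units.smul_def, evalAt_smul he, h F hF, mul_zero]
      exact h2 hqU
    obtain ⟨F, hF, hFq⟩ := h1
    rw [holdsForGeneral_iff]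
    refine ⟨_, polyFun_comp (evalAt_mem_polyFun F) hφ, ⟨q, hFq⟩, fun x hx hx0 => ?_⟩
    by_contra hxU
    have h3 : Projectivization.mk K (φ x) hx0 ∈ projZeroLocus S := hUS ▸ hxU
    obtain ⟨e, he⟩ := hS F hF
    obtain ⟨a, ha⟩ := Projectivization.exists_smul_eq_mk_rep K (φ x) hx0
    have h4 := h3 F hF
    rw [← ha, Units.smul_def, evalAt_smul he] at h4
    exact hx ((mul_eq_zero.1 h4).resolve_left (pow_ne_zero _ a.ne_zero))
  intro U W hU hW hUne hWne
  obtain ⟨ψ, hψ⟩ := not_forall.1 (mt (Module.forall_dual_apply_eq_zero_iff K (φ q₀)).1 hq₀)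
  have h0 : HoldsForGeneral K fun q => φ q ≠ 0 := by
    rw [holdsForGeneral_iff]
    refine ⟨_, hφ ψ, ⟨q₀, hψ⟩, fun v hv h => hv ?_⟩
    rw [h, map_zero]
  obtain ⟨q, ⟨hqU, hqW⟩, hq⟩ := (((key U hU hUne).and (key W hW hWne)).and h0).exists
  exact ⟨_, ⟨q, hq, rfl⟩, hqU hq, hqW hq⟩

theorem mem_coneIdeal_projImage {e : ℕ} (he : 0 < e)
    (hhom : ∀ (t : K) (q : E), φ (t • q) = t ^ e • φ q) (hne : ∃ q, φ q ≠ 0)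
    {F : MvPolynomial (Module.Dual K V) K} :
    F ∈ coneIdeal (projImage K φ) ↔ ∀ q, evalAt (φ q) F = 0 := by
  constructor
  · intro hF q
    by_cases hq : φ q = 0
    · obtain ⟨q₀, hq₀⟩ := hne
      have := (mk_mem_componentLocus hq₀).1 (hF ⟨q₀, hq₀, rfl⟩) 0
      rwa [hq, ← zero_smul K (φ q₀)]
    · simpa using (mk_mem_componentLocus hq).1 (hF ⟨q, hq, rfl⟩) 1
  · rintro h _ ⟨q, hq, rfl⟩
    rw [mk_mem_componentLocus]
    intro t
    obtain ⟨P, hP⟩ := exists_polynomial_eval_eq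
      (polyFun_comp (evalAt_mem_polyFun F) (isPolyMap_smul_const (φ q)))
    -- Homogeneity controls only the scalars `t ^ e`. If `P(t)` is the value of `F` at `t • φ q`,
    -- then `P(t ^ e)` vanishes identically, so `P = 0` without extracting roots.
    have hexp : Polynomial.expand K e P = 0 := Polynomial.funext fun t => by
      rw [Polynomial.expand_eval, hP, ← hhom, h, Polynomial.eval_zero]
    rw [← hP, (Polynomial.expand_eq_zero he).1 hexp, Polynomial.eval_zero]

/-- The cone over the closure of the image is cut out by the kernel of the pullback. -/
theorem exists_pullback {ι : Type*} [Fintype ι] (b : (ι → K) ≃ₗ[K] E) (hφ : IsPolyMap K φ) {e : ℕ}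
    (he : 0 < e) (hhom : ∀ (t : K) (q : E), φ (t • q) = t ^ e • φ q) (hne : ∃ q, φ q ≠ 0) :
    ∃ θ : MvPolynomial (Module.Dual K V) K →ₐ[K] MvPolynomial ι K,
      (∀ ψ c, eval c (θ (X ψ)) = ψ (φ (b c))) ∧ coneIdeal (projImage K φ) = RingHom.ker θ := by
  have hpoly : ∀ ψ : Module.Dual K V, ∃ P : MvPolynomial ι K, ∀ c, eval c P = ψ (φ (b c)) :=
    fun ψ => exists_mvPolynomial_eval_eq (polyFun_comp (hφ ψ) (LinearMap.isPolyMap b.toLinearMap))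
  choose g hg using hpoly
  have heval : ∀ F c, eval c (aeval g F) = evalAt (φ (b c)) F := fun F c => by
    induction F using MvPolynomial.induction_on with
    | C a => simp [evalAt]
    | add p q hp hq =>
      rw [evalAt] at *
      rw [map_add, map_add, map_add, hp, hq]
    | mul_X p ψ hp =>
      rw [evalAt] at *
      rw [map_mul, map_mul, map_mul, hp, aeval_X, hg, eval_X]
  refine ⟨aeval g, fun ψ c => by rw [aeval_X, hg], ?_⟩
  ext F
  rw [mem_coneIdeal_projImage he hhom hne, RingHom.mem_ker]
  constructor
  · intro h
    refine MvPolynomial.funext fun c => ?_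
    rw [map_zero, ← h (b c)]
    exact heval F c
  · intro h q
    rw [← b.apply_symm_apply q, ← heval]
    erw [h]
    simp

end Image

end ConeIdeal

/-! ### Differentials and the transcendence degree of the image. -/

section Deriv

variable {K V E : Type*} [Field K] [CharZero K] [AddCommGroup V] [Module K V] [AddCommGroup E]
  [Module K E] {φ : E → V}

/-- `D` is the differential at `p` of the map `φ`, which is polynomial along lines through `p`. -/
def HasLineDeriv (φ : E → V) (p : E) (D : E →ₗ[K] V) : Prop :=
  ∀ (ψ : Module.Dual K V) (h : E), ∃ P : Polynomial K,
    (∀ t, P.eval t = ψ (φ (p + t • h))) ∧ P.coeff 1 = ψ (D h)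

/-- Restriction of a polynomial to the line through `c` in the direction `h`. -/
noncomputable def lineHom {ι : Type*} (c h : ι → K) : MvPolynomial ι K →ₐ[K] Polynomial K :=
  aeval fun j => Polynomial.C (c j) + Polynomial.C (h j) * Polynomial.X

omit [CharZero K] in
theorem lineHom_X {ι : Type*} (c h : ι → K) (j : ι) :
    lineHom c h (X j) = Polynomial.C (c j) + Polynomial.C (h j) * Polynomial.X := by
  rw [lineHom, aeval_X]

omit [CharZero K] in
theorem eval_lineHom {ι : Type*} (c h : ι → K) (t : K) (g : MvPolynomial ι K) :
    (lineHom c h g).eval t = eval (c + t • h) g := by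
  induction g using MvPolynomial.induction_on with
  | C a => simp
  | add p q hp hq => simp [hp, hq]
  | mul_X p j hp =>
    simp only [map_mul, Polynomial.eval_mul, hp, lineHom_X, Polynomial.eval_add, Polynomial.eval_C,
      Polynomial.eval_X, eval_X, Pi.add_apply, Pi.smul_apply, smul_eq_mul]
    ring

omit [CharZero K] in
theorem coeff_one_lineHom {ι : Type*} [DecidableEq ι] (c : ι → K) (i : ι) (g : MvPolynomial ι K) :
    (lineHom c (Pi.single i 1) g).coeff 1 = eval c (pderiv i g) := by
  have h0 : ∀ g : MvPolynomial ι K, (lineHom c (Pi.single i 1) g).coeff 0 = eval c g := fun g => by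
    rw [Polynomial.coeff_zero_eq_eval_zero, eval_lineHom, zero_smul, add_zero]
  induction g using MvPolynomial.induction_on with
  | C a => simp
  | add p q hp hq => simp [hp, hq]
  | mul_X p j hp =>
    rw [map_mul, Polynomial.mul_coeff_one, hp, h0, lineHom_X, Derivation.leibniz, pderiv_X]
    by_cases hij : j = i
    · subst hij
      simp
      ring
    · simp [Pi.single_eq_of_ne hij]
      ring

theorem exists_ne_zero_of_hasLineDeriv {p : E} {D : E →ₗ[K] V} (hD : HasLineDeriv φ p D)
    (hinj : Function.Injective D) [Nontrivial E] : ∃ q, φ q ≠ 0 := by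
  by_contra! h
  obtain ⟨v, hv⟩ := exists_ne (0 : E)
  refine hv (hinj ?_)
  rw [map_zero, ← Module.forall_dual_apply_eq_zero_iff K]
  intro ψ
  obtain ⟨P, hP, hP1⟩ := hD ψ v
  have : P = 0 := Polynomial.funext fun t => by rw [hP, h, map_zero, Polynomial.eval_zero]
  rw [← hP1, this, Polynomial.coeff_zero]

omit [CharZero K] in
theorem HasLineDeriv.comp_subtype {p : E} {D : E →ₗ[K] V} (hD : HasLineDeriv φ p D)
    (S : Submodule K E) (hp : p ∈ S) :
    HasLineDeriv (fun q : S => φ q) ⟨p, hp⟩ (D ∘ₗ S.subtype) :=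
  fun ψ h => hD ψ h

variable [FiniteDimensional K E] {e : ℕ}

theorem le_finrank_of_indepMod (hφ : IsPolyMap K φ) (he : 0 < e)
    (hhom : ∀ (t : K) (q : E), φ (t • q) = t ^ e • φ q) (hne : ∃ q, φ q ≠ 0) {r : ℕ}
    (h : IndepMod K (coneIdeal (projImage K φ)) r) : r ≤ finrank K E := by
  obtain ⟨θ, -, hθ⟩ := exists_pullback (finBasis K E).equivFun.symm hφ he hhom hne
  rw [hθ] at h
  exact h.le_of_ker θ

/-- A left inverse of the differential supplies functionals whose pullbacks have the identity as
Jacobian matrix at `p`, so the Jacobian criterion makes them independent. -/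
theorem indepMod_finrank (hφ : IsPolyMap K φ) (he : 0 < e)
    (hhom : ∀ (t : K) (q : E), φ (t • q) = t ^ e • φ q) (hne : ∃ q, φ q ≠ 0)
    {p : E} {D : E →ₗ[K] V} (hD : HasLineDeriv φ p D) (hinj : Function.Injective D) :
    IndepMod K (coneIdeal (projImage K φ)) (finrank K E) := by
  classical
  let b := (finBasis K E).equivFun.symm
  obtain ⟨θ, hθ, hker⟩ := exists_pullback b hφ he hhom hne
  rw [hker]
  obtain ⟨R, hR⟩ := (D ∘ₗ b.toLinearMap).exists_leftInverse_of_injective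
    (LinearMap.ker_eq_bot.2 (hinj.comp b.injective))
  let ψ : Fin (finrank K E) → Module.Dual K V := fun a => LinearMap.proj a ∘ₗ R
  refine indepMod_of_ker θ (fun a => X (ψ a))
    (algebraicIndependent_of_pderiv (c := b.symm p) fun i j => ?_)
  rw [← coeff_one_lineHom]
  obtain ⟨P, hP, hP1⟩ := hD (ψ i) (b (Pi.single j 1))
  have h1 : ψ i (D (b (Pi.single j 1))) = if i = j then 1 else 0 := by
    have := congrFun (LinearMap.congr_fun hR (Pi.single j 1)) i
    simpa [ψ, Pi.single_apply] using this
  rw [← h1, ← hP1]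
  congr 1
  refine Polynomial.funext fun t => ?_
  rw [eval_lineHom, hθ, hP, map_add, map_smul, b.apply_symm_apply]

end Deriv

/-! ### Dimension of the closure of an image. -/

section Dimension

attribute [local instance] projZariski

/-- The closure of the image in projective space of a nonzero polynomial map. -/
def imageClosure {K V E : Type*} [Field K] [Infinite K] [AddCommGroup V] [Module K V]
    [AddCommGroup E] [Module K E] (φ : E → V) (hφ : IsPolyMap K φ) (hne : ∃ q, φ q ≠ 0) :
    IrreducibleCloseds (Projectivization K V) where
  carrier := closure (projImage K φ)
  isIrreducible' := (isIrreducible_projImage hφ hne).closure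
  isClosed' := isClosed_closure

variable {K V : Type*} [Field K] [CharZero K] [AddCommGroup V] [Module K V]

universe u

theorem le_height_imageClosure {e : ℕ} (he : 0 < e) (s : ℕ) :
    ∀ {E : Type u} [AddCommGroup E] [Module K E] [FiniteDimensional K E] {φ : E → V}
      (hφ : IsPolyMap K φ) (hne : ∃ q, φ q ≠ 0)
      (_ : ∀ (t : K) (q : E), φ (t • q) = t ^ e • φ q) {p : E} {D : E →ₗ[K] V}
      (_ : HasLineDeriv φ p D) (_ : Function.Injective D) (_ : finrank K E = s + 1),
      (s : ℕ∞) ≤ Order.height (imageClosure φ hφ hne) := by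
  induction s with
  | zero => intros; simp
  | succ s ih =>
    intro E _ _ _ φ hφ hne hhom p D hD hinj hs
    have hlt : Submodule.span K {p} < ⊤ := by
      refine lt_top_iff_ne_top.2 fun h => ?_
      have h1 := finrank_span_le_card (R := K) ({p} : Set E)
      rw [h, finrank_top, Set.toFinset_singleton, Finset.card_singleton] at h1
      omega
    -- The hyperplane is taken through `p`, so that the restricted map still has an injective
    -- differential at `p`. It exists because `E` has dimension at least two.
    obtain ⟨ψ, hψ, hle⟩ := Submodule.exists_le_ker_of_lt_top _ hlt
    let S : Submodule K E := LinearMap.ker ψ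
    have hp : p ∈ S := hle (Submodule.mem_span_singleton_self p)
    have hS : finrank K S = s + 1 := by
      have := Module.Dual.finrank_ker_add_one_of_ne_zero hψ
      change finrank K (LinearMap.ker ψ) = s + 1
      omega
    have : Nontrivial S := nontrivial_of_finrank_pos (R := K) (by omega)
    have hDS := hD.comp_subtype S hp
    have hinjS : Function.Injective (D ∘ₗ S.subtype) := hinj.comp S.injective_subtype
    have hφS : IsPolyMap K fun q : S => φ q := fun ψ =>
      polyFun_comp (hφ ψ) (LinearMap.isPolyMap S.subtype)
    have hneS := exists_ne_zero_of_hasLineDeriv hDS hinjS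
    have hhomS : ∀ (t : K) (q : S), φ (t • q : S) = t ^ e • φ q := fun t q => hhom t q
    have h := ih hφS hneS hhomS hDS hinjS hS
    have hlt : imageClosure _ hφS hneS < imageClosure φ hφ hne := by
      refine lt_of_le_of_ne (closure_mono ?_) fun heq => ?_
      · rintro _ ⟨q, hq, rfl⟩
        exact ⟨q, hq, rfl⟩
      · have h1 := indepMod_finrank hφ he hhom hne hD hinj
        have h2 : coneIdeal (projImage K φ) = coneIdeal (projImage K fun q : S => φ q) := by
          rw [← coneIdeal_closure, ← coneIdeal_closure (projImage K fun q : S => φ q)]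
          exact congrArg (fun Z : IrreducibleCloseds (Projectivization K V) =>
            coneIdeal (Z : Set (Projectivization K V))) heq.symm
        rw [h2] at h1
        have := le_finrank_of_indepMod hφS he hhomS hneS h1
        omega
    calc ((s + 1 : ℕ) : ℕ∞) = s + 1 := by push_cast; rfl
      _ ≤ Order.height (imageClosure _ hφS hneS) + 1 := by gcongr
      _ ≤ _ := Order.height_add_one_le hlt

/-- The closure of the image of a homogeneous polynomial map with injective differential somewhere
has the dimension of the source. -/
theorem projDim_closure_projImage {E : Type*} [AddCommGroup E] [Module K E]
    [FiniteDimensional K E] {e : ℕ} (he : 0 < e) {φ : E → V} (hφ : IsPolyMap K φ)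
    (hhom : ∀ (t : K) (q : E), φ (t • q) = t ^ e • φ q) {p : E} {D : E →ₗ[K] V}
    (hD : HasLineDeriv φ p D) (hinj : Function.Injective D) (hE : 0 < finrank K E) :
    projDim (closure (projImage K φ)) = ((finrank K E - 1 : ℕ) : WithBot ℕ∞) := by
  have : Nontrivial E := nontrivial_of_finrank_pos hE
  have hne := exists_ne_zero_of_hasLineDeriv hD hinj
  refine (topologicalKrullDim_eq_height (imageClosure φ hφ hne)).trans ?_
  have h1 := le_height_imageClosure he (finrank K E - 1) hφ hne hhom hD hinj (by omega)
  have h2 : Order.height (imageClosure φ hφ hne) ≤ (finrank K E - 1 : ℕ) := by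
    refine height_le_of_indepMod _ _ fun r hr => ?_
    have h3 : coneIdeal (imageClosure φ hφ hne : Set (Projectivization K V)) =
      coneIdeal (projImage K φ) := coneIdeal_closure _
    rw [h3] at hr
    have := le_finrank_of_indepMod hφ he hhom hne hr
    omega
  rw [le_antisymm h2 h1]
  rfl

end Dimension

/-! ### Sums of powers and the secant variety. -/

section SumPow

variable {n k m d : ℕ}

/-- The sum of the `(d + 1)`-st powers of `m` forms. -/
noncomputable def sumPow (d : ℕ) (q : Fin m → Form n k) : Form n (k * (d + 1)) :=
  ∑ i, formPow (d + 1) (q i)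

theorem coe_sumPow (q : Fin m → Form n k) :
    (sumPow d q : MvPolynomial (Fin n) ℂ) = ∑ i, (q i : MvPolynomial (Fin n) ℂ) ^ (d + 1) := by
  simp [sumPow, formPow]

theorem formPow_smul (t : ℂ) (q : Form n k) : formPow d (t • q) = t ^ d • formPow d q :=
  Subtype.ext (smul_pow t (q : MvPolynomial (Fin n) ℂ) d)

theorem sumPow_smul (t : ℂ) (q : Fin m → Form n k) :
    sumPow d (t • q) = t ^ (d + 1) • sumPow d q := by
  simp [sumPow, formPow_smul, Finset.smul_sum]

theorem isPolyMap_sumPow : IsPolyMap ℂ (sumPow d : (Fin m → Form n k) → _) := by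
  refine isPolyMap_form ?_
  simp only [coe_sumPow]
  have h1 : ∀ i, (fun p : Fin m → Form n k => (p i : MvPolynomial (Fin n) ℂ)) ∈
      coeffPoly ℂ _ (Fin n) := fun i =>
    linear_mem_coeffPoly ((Form n k).subtype ∘ₗ
      (LinearMap.proj i : (Fin m → Form n k) →ₗ[ℂ] Form n k))
  have h2 := (coeffPoly ℂ (Fin m → Form n k) (Fin n)).sum_mem (t := Finset.univ)
    fun i _ => (coeffPoly ℂ _ _).pow_mem (h1 i) (d + 1)
  convert h2 using 1
  ext1 p
  simp

theorem hasLineDeriv_sumPow (p : Fin m → Form n k) :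
    HasLineDeriv (sumPow d) p ((d + 1 : ℂ) • sumMulPow d p) := by
  intro ψ h
  obtain ⟨ψ', hψ'⟩ := LinearMap.exists_extend ψ
  have hψ : ∀ x, ψ x = ψ' (x : MvPolynomial (Fin n) ℂ) := fun x => by rw [← hψ']; rfl
  refine ⟨∑ i, ∑ j ∈ Finset.range (d + 1 + 1), Polynomial.monomial j
    (((d + 1).choose j : ℂ) * ψ' ((h i : MvPolynomial (Fin n) ℂ) ^ j * (p i : _) ^ (d + 1 - j))),
    fun t => ?_, ?_⟩
  · rw [hψ, coe_sumPow, map_sum, Polynomial.eval_finsetSum]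
    refine Finset.sum_congr rfl fun i _ => ?_
    have h1 : (((p + t • h) i : Form n k) : MvPolynomial (Fin n) ℂ) = t • (h i).1 + (p i).1 := by
      simp [add_comm]
    rw [h1, add_pow, map_sum, Polynomial.eval_finsetSum]
    refine Finset.sum_congr rfl fun j _ => ?_
    have h2 : (t • (h i).1) ^ j * (p i).1 ^ (d + 1 - j) *
        ((d + 1).choose j : MvPolynomial (Fin n) ℂ) =
        (t ^ j * ((d + 1).choose j : ℂ)) • ((h i).1 ^ j * (p i).1 ^ (d + 1 - j)) := by
      rw [smul_pow, smul_eq_C_mul, smul_eq_C_mul, map_mul, map_natCast]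
      ring
    rw [h2, map_smul, Polynomial.eval_monomial, smul_eq_mul]
    ring
  · rw [hψ, LinearMap.smul_apply, sumMulPow_apply, Polynomial.finsetSum_coeff]
    simp only [Submodule.coe_smul, Submodule.coe_sum, coe_mulPow, map_smul, map_sum, smul_eq_mul,
      Finset.mul_sum, Polynomial.finsetSum_coeff, Polynomial.coeff_monomial, Finset.sum_ite_eq',
      Finset.mem_range]
    refine Finset.sum_congr rfl fun i _ => ?_
    rw [if_pos (by omega), Nat.choose_one_right, pow_one, Nat.add_sub_cancel, mul_comm (h i).1]
    push_cast
    rfl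

/-- The union of the spans of `m` powers is the set of sums of `m` powers. -/
theorem iUnion_span_eq_projImage (hn : 0 < n) :
    (⋃ x : Fin m → powerVariety n k (d + 1), {y : Projectivization ℂ (Form n (k * (d + 1))) |
      y.submodule ≤ ⨆ i, (x i : Projectivization ℂ (Form n (k * (d + 1)))).submodule}) =
      projImage ℂ (sumPow d : (Fin m → Form n k) → _) := by
  classical
  ext y
  simp only [Set.mem_iUnion, Set.mem_ofPred_eq]
  constructor
  · rintro ⟨x, hx⟩
    induction y with
    | h v hv =>
      choose q hq hxq using fun i => (x i).2
      rw [Projectivization.submodule_mk, Submodule.span_singleton_le_iff_mem] at hx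
      simp only [hxq, Projectivization.submodule_mk] at hx
      rw [← Submodule.span_range_eq_iSup, Submodule.mem_span_range_iff_exists_fun] at hx
      obtain ⟨c, rfl⟩ := hx
      -- Roots of the coefficients are absorbed into the forms.
      choose a ha using fun i => IsAlgClosed.exists_pow_nat_eq (c i) (Nat.succ_pos d)
      have h : ∑ i, c i • formPow (d + 1) (q i) = sumPow d fun i => a i • q i := by
        simp only [sumPow, formPow_smul, ha]
      refine ⟨fun i => a i • q i, h ▸ hv, ?_⟩
      congr 1
  · rintro ⟨q, hq, rfl⟩
    obtain ⟨q₀, hq₀⟩ := form_nontrivial hn k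
    -- A zero form gives no point of the variety; any nonzero form may replace it, since its summand
    -- is zero.
    let q' : Fin m → Form n k := fun i => if q i = 0 then q₀ else q i
    have hq' : ∀ i, q' i ≠ 0 := fun i => by
      by_cases h : q i = 0
      · simpa [q', h] using hq₀
      · simp [q', h]
    refine ⟨fun i => ⟨_, q' i, hq' i, rfl⟩, ?_⟩
    rw [Projectivization.submodule_mk, Submodule.span_singleton_le_iff_mem]
    refine Submodule.sum_mem _ fun i _ => Submodule.mem_iSup_of_mem i ?_
    rw [Projectivization.submodule_mk]
    by_cases h : q i = 0
    · have h1 : formPow (d + 1) (q i) = 0 := Subtype.ext (by simp [formPow, h])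
      rw [h1]
      exact Submodule.zero_mem _
    · have h1 : q' i = q i := by simp [q', h]
      rw [h1]
      exact Submodule.mem_span_singleton_self _

theorem projDim_secantVariety (hn : 0 < n) (hm : 0 < m)
    (hbound : m * dimForm n k + dimForm n k ^ 2 ≤ dimForm n (k * (d + 1))) :
    projDim (secantVariety m (powerVariety n k (d + 1))) =
      ((m * dimForm n k - 1 : ℕ) : WithBot ℕ∞) := by
  obtain ⟨p, hp⟩ := (holdsForGeneral_finrank_mulPow hn hbound).exists
  have hE : finrank ℂ (Fin m → Form n k) = m * dimForm n k := by
    rw [finrank_pi_fintype]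
    simp [dimForm]
  have hd : (d + 1 : ℂ) ≠ 0 := by exact_mod_cast Nat.succ_ne_zero d
  have hinj : Function.Injective ((d + 1 : ℂ) • sumMulPow d p) := fun a b hab =>
    sumMulPow_injective hp (smul_right_injective _ hd hab)
  have h := projDim_closure_projImage (Nat.succ_pos d) isPolyMap_sumPow sumPow_smul
    (hasLineDeriv_sumPow p) hinj (by
      rw [hE]
      exact Nat.mul_pos hm (dimForm_pos hn k))
  rw [hE] at h
  rw [secantVariety, iUnion_span_eq_projImage hn]
  exact h

end SumPow

end PowersOfForms

/-! ### The main theorem. -/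

theorem mainTheorem5 (n k d m : ℕ) (hn : 0 < n) (hk : 0 < k) (hd : 0 < d) (hm : 0 < m)
    (hbound : (m : ℚ) ≤ (PowersOfForms.dimForm n (k * d) : ℚ) / (PowersOfForms.dimForm n k : ℚ)
      - (PowersOfForms.dimForm n k : ℚ)) :
    PowersOfForms.projDim
        (PowersOfForms.secantVariety m (PowersOfForms.powerVariety n k d))
      = ((m * PowersOfForms.dimForm n k - 1 : ℕ) : WithBot ℕ∞) ∧
    PowersOfForms.HoldsForGeneral ℂ (fun p : Fin m → PowersOfForms.Form n k =>
      Module.finrank ℂ (PowersOfForms.idealPart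
        (fun i => (p i : MvPolynomial (Fin n) ℂ) ^ (d - 1)) (k * d))
      = m * PowersOfForms.dimForm n k) := by
  -- From here the exponent is `d + 1`, so the tangent spaces involve `d`-th powers and no truncated
  -- subtraction remains.
  obtain ⟨d, rfl⟩ := Nat.exists_eq_add_of_lt hd
  rw [zero_add] at *
  have hb : m * PowersOfForms.dimForm n k + PowersOfForms.dimForm n k ^ 2 ≤
      PowersOfForms.dimForm n (k * (d + 1)) := by
    have hN : (0 : ℚ) < PowersOfForms.dimForm n k := by
      exact_mod_cast PowersOfForms.dimForm_pos hn k
    have h1 := (le_div_iff₀ hN).1 (le_sub_iff_add_le.1 hbound)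
    have h2 : ((m * PowersOfForms.dimForm n k + PowersOfForms.dimForm n k ^ 2 : ℕ) : ℚ) ≤
        PowersOfForms.dimForm n (k * (d + 1)) := by
      push_cast
      linarith
    exact_mod_cast h2
  refine ⟨PowersOfForms.projDim_secantVariety hn hm hb,
    (PowersOfForms.holdsForGeneral_finrank_mulPow hn hb).mono fun p hp => ?_⟩
  rw [Nat.add_sub_cancel, PowersOfForms.idealPart_eq_map, ← hp]
  exact (Submodule.equivMapOfInjective _ (Submodule.injective_subtype _) _).finrank_eq.symm
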